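/- Let $\Omega=\{0,1\}^{\mathbb N}$ with the uniform Lebesgue measure $\lambda$. A \emph{partition refinement} of $\Omega$ is a partial function $(t,x)\mapsto S^t(x)$ from $\mathbb N\times\{0,1\}^*$ to nonempty subsets of $\Omega$ (the \emph{parts}) such that: $S^0(\Lambda)=\Omega$ for the empty string $\Lambda$; if $S^t(x)$ is defined, then $S^{t'}(x)=S^t(x)$ for all $t'>t$; and if $S$ is defined at one of $(t,x0)$, $(t,x1)$, then it is defined at both, $t\ge 1$, $S^{t-1}(x)$ is defined, and $S^t(x0),S^t(x1)$ partition $S^t(x)$. The coordinate $x$ is \emph{terminal at $t$} if $S^t(x)$ is defined and $S^t(x0),S^t(x1)$ are not; its part is \emph{split at $t$} (into $S^t(x0),S^t(x1)$) if $x$ is terminal at $t-1$ and $S^t(x0),S^t(x1)$ are defined. A (general) \emph{betting strategy} is a pair $(S,\mu)$ where $S$ is a partition refinement of $\Omega$ all of whose parts are clopen, and $\mu:\{0,1\}^*\to[0,\infty)$ satisfies $\mu(x)=\mu(x0)+\mu(x1)$ for all $x$. It is \emph{computable} if $S$ is a computable partial function (a clopen set being given by a finite list of strings whose cylinders have it as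 their union) and $\mu(x)$ is a real computable uniformly in those $x$ for which some $S^t(x)$ is defined. The capital of such an $x$ is $c(x)=\mu(x)/\lambda(S^t(x))$, and $\hat c(x)$ is the maximum of $c$ over all prefixes of $x$, including $x$. Up to time $t$ the strategy achieves capital $\hat c(x)$ on $\sigma\in\Omega$ if $x$ is terminal at $t$ and $\sigma\in S^t(x)$. The strategy \emph{wins} on $\sigma$ if the capital it achieves on $\sigma$ is unbounded as $t\to\infty$. Let $\pi=(p_1,p_2,\dots)$ be a sequence of distinct positions in $\mathbb N$. For $\sigma\in\Omega$ and $\ell\in\mathbb N$, let $[\rho^\sigma_\ell]$ be the set of sequences that agree with $\sigma$ at all positions outside $\{p_1,\dots,p_\ell\}$. The number of times the part with coordinate $x$ \emph{was split on} $\rho^\sigma_\ell$ is the number of proper prefixes $y$ of $x$ such that the part with coordinate $y$ is split (at some time) into two parts both of which intersect $[\rho^\sigma_\ell]$. For $f:\mathbb N\to\mathbb R$, the strategy \emph{on $\pi$ has splits upper bounded by $f$} if for $\lambda$-almost every $\sigma$, for all but finitely many $\ell$, every part that contains $\sigma$ was split on $\rho^\sigma_\ell$ at most $f(\ell)$ times.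 A sequence is \emph{non-Martin-Löf random} if it lies in $\bigcap_n\bigcup_k[f(n,k)]$ for some computable $f:\mathbb N^2\to\{0,1\}^*$ such that, with $U_n=\bigcup_k[f(n,k)]$, we have $\lambda(U_n)<2^{-n}$ and $U_{n+1}\subseteq U_n$ for all $n$, where $[s]$ is the set of sequences with prefix $s$. \textbf{Theorem.} Let $A$ and $B$ be computable betting strategies, let $\pi$ be a computable sequence of distinct positions, and let $g:\mathbb N\to\mathbb R$ be a computable function that is unbounded above. If both $A$ and $B$ on $\pi$ have splits upper bounded by $\ell-\log_2\ell-g(\ell)$, then there is a non-Martin-Löf random sequence on which neither $A$ nor $B$ wins. -/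

import Mathlib

open scoped NNReal

namespace GenBet

/-- Infinite binary sequences, with positions indexed by `ℕ`. -/
abbrev BinSeq : Type := ℕ → Bool

/-- The basic set `[s]`: all sequences having the finite string `s` as a prefix. -/
def basicSet (s : List Bool) : Set BinSeq :=
  {σ | ∀ (i : ℕ) (h : i < s.length), σ i = s[i]}

/-- The uniform Lebesgue measure on infinite binary sequences (independent fair bits). -/
noncomputable def coinMeasure : MeasureTheory.Measure BinSeq :=
  MeasureTheory.Measure.infinitePi fun _ : ℕ => (PMF.uniformOfFintype Bool).toMeasure

/-! ### Martin-Löf tests -/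

/-- The `n`-th level of the family of basic sets coded by `f`. -/
def level (f : ℕ × ℕ → List Bool) (n : ℕ) : Set BinSeq :=
  ⋃ k, basicSet (f (n, k))

/-- `f` is a Martin-Löf test: a computable double sequence of basic sets, with decreasing levels
whose `n`-th one has size less than `2 ^ (-n)`. -/
def IsMLTest (f : ℕ × ℕ → List Bool) : Prop :=
  Computable f ∧ (∀ n, coinMeasure (level f n) < 2⁻¹ ^ n) ∧ ∀ n, level f (n + 1) ⊆ level f n

/-- A sequence is Martin-Löf random if it fails no Martin-Löf test, that is, for every test
some level misses it. -/
def IsMLRandom (σ : BinSeq) : Prop :=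
  ∀ f, IsMLTest f → ∃ n, σ ∉ level f n

/-! ### Computable real-valued functions -/

/-- The values of the real function `F` at the points of `D` are uniformly computable reals: one
algorithm, given `x ∈ D` and `n`, halts with an integer `z` such that `z / 2 ^ n` is within
`2 ^ (-n)` of `F x`.  Outside `D` nothing is required. -/
def IsComputableRealOn {α : Type} [Primcodable α] (D : Set α) (F : α → ℝ) : Prop :=
  ∃ a : α × ℕ →. ℤ, Partrec a ∧
    ∀ x ∈ D, ∀ n : ℕ, ∃ z ∈ a (x, n), |F x - (z : ℝ) / 2 ^ n| ≤ 1 / 2 ^ n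

/-! ### Partition refinements -/

/-- A partition refinement of `Ω`: a partial function of a time `t` and a coordinate `x` (a finite
string) whose values, the parts, are nonempty subsets of `Ω`.  The children of a coordinate `x` are
`x ++ [false]` and `x ++ [true]`. -/
structure PartitionRefinement (Ω : Type) where
  part : ℕ → List Bool → Part (Set Ω)
  part_nonempty : ∀ t x v, v ∈ part t x → v.Nonempty
  root : Set.univ ∈ part 0 []
  persist : ∀ t t' x v, t ≤ t' → v ∈ part t x → v ∈ part t' x
  child_dom : ∀ t x b, (part t (x ++ [b])).Dom →
    (part t (x ++ [!b])).Dom ∧ ∃ s, t = s + 1 ∧ (part s x).Dom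
  child_partition : ∀ t x v v₀ v₁, v ∈ part t x →
    v₀ ∈ part t (x ++ [false]) → v₁ ∈ part t (x ++ [true]) → Disjoint v₀ v₁ ∧ v₀ ∪ v₁ = v

namespace PartitionRefinement

variable {Ω : Type}

/-- The coordinates at which some part is eventually defined. -/
def coords (S : PartitionRefinement Ω) : Set (List Bool) :=
  {x | ∃ t, (S.part t x).Dom}

/-- The part with coordinate `x`, which does not depend on the time at which it is read (and is
empty if it is never defined). -/
def partSet (S : PartitionRefinement Ω) (x : List Bool) : Set Ω :=
  {σ | ∃ t, ∃ v ∈ S.part t x, σ ∈ v}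

/-- The coordinate `x` is terminal at time `t`. -/
def Terminal (S : PartitionRefinement Ω) (t : ℕ) (x : List Bool) : Prop :=
  (S.part t x).Dom ∧ ¬ (S.part t (x ++ [false])).Dom ∧ ¬ (S.part t (x ++ [true])).Dom

/-- The part with coordinate `x` is split at time `t` into `v₀` and `v₁`. -/
def SplitAt (S : PartitionRefinement Ω) (t : ℕ) (x : List Bool) (v₀ v₁ : Set Ω) : Prop :=
  (∃ s, t = s + 1 ∧ S.Terminal s x) ∧ v₀ ∈ S.part t (x ++ [false]) ∧ v₁ ∈ S.part t (x ++ [true])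

end PartitionRefinement

/-! ### Restrictions and counting splits -/

/-- A restriction: a map from a subset of the positions to bits. -/
abbrev Restriction : Type := ℕ → Option Bool

/-- The set `[r]` of sequences consistent with the restriction `r`. -/
def Restriction.cyl (r : Restriction) : Set BinSeq :=
  {σ | ∀ p b, r p = some b → σ p = b}

/-- The restriction that agrees with `σ` on all positions except the first `l` positions
`π 0, …, π (l - 1)` of `π`, which it leaves free. -/
noncomputable def tailRestriction (π : ℕ → ℕ) (l : ℕ) (σ : BinSeq) : Restriction := by
  classical
  exact fun p => if ∃ i < l, π i = p then none else some (σ p)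

/-- At some time the part with coordinate `x` is split into two parts, both meeting `[r]`. -/
def SplitOn (S : PartitionRefinement BinSeq) (r : Restriction) (x : List Bool) : Prop :=
  ∃ t v₀ v₁, S.SplitAt t x v₀ v₁ ∧ (v₀ ∩ r.cyl).Nonempty ∧ (v₁ ∩ r.cyl).Nonempty

/-- How many times the part with coordinate `x` was split on `r`: the number of proper prefixes
of `x` whose part is split on `r`. -/
noncomputable def splitCount (S : PartitionRefinement BinSeq) (r : Restriction)
    (x : List Bool) : ℕ :=
  Set.ncard {y : List Bool | y <+: x ∧ y ≠ x ∧ SplitOn S r y}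

/-! ### Betting strategies -/

/-- A mass function on finite strings. -/
structure MassFunction where
  mass : List Bool → ℝ≥0
  mass_split : ∀ x, mass x = mass (x ++ [false]) + mass (x ++ [true])

/-- A general betting strategy: a partition refinement of the set of infinite binary sequences
into clopen parts, together with a mass function. -/
structure BettingStrategy where
  ref : PartitionRefinement BinSeq
  clopen : ∀ t x v, v ∈ ref.part t x → IsClopen v
  mu : MassFunction

namespace BettingStrategy

/-- A betting strategy is computable if its partition refinement is a computable partial function
(clopen parts being given as finite lists of strings, meaning the union of their basic sets), and
the mass function is computable at every coordinate at which a part is ever defined. -/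
def IsComputable (B : BettingStrategy) : Prop :=
  (∃ code : ℕ × List Bool →. List (List Bool), Partrec code ∧
    ∀ t x, B.ref.part t x = (code (t, x)).map fun c => ⋃ s ∈ c, basicSet s) ∧
  IsComputableRealOn B.ref.coords fun x => (B.mu.mass x : ℝ)

/-- The capital `μ(x) / λ(S(x))` of a coordinate `x` of the strategy. -/
noncomputable def capital (B : BettingStrategy) (x : List Bool) : ℝ≥0 :=
  B.mu.mass x / (coinMeasure (B.ref.partSet x)).toNNReal

/-- The maximum of the capital over all prefixes of `x`, including `x`. -/
noncomputable def maxCapital (B : BettingStrategy) (x : List Bool) : ℝ≥0 :=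
  x.inits.toFinset.sup B.capital

/-- Up to time `t` the strategy achieved capital `c` when betting on `σ`. -/
def Achieves (B : BettingStrategy) (t : ℕ) (σ : BinSeq) (c : ℝ≥0) : Prop :=
  ∃ x, B.ref.Terminal t x ∧ (∃ v ∈ B.ref.part t x, σ ∈ v) ∧ c = B.maxCapital x

/-- The strategy wins on `σ` if the capital it achieves on `σ` is unbounded. -/
def Wins (B : BettingStrategy) (σ : BinSeq) : Prop :=
  ∀ M : ℝ≥0, ∃ t c, B.Achieves t σ c ∧ M < c

/-- On the sequence of positions `π`, the strategy has splits upper bounded by `f`: for almost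
every `σ`, for all but finitely many `l`, every part that contains `σ` was split at most `f l` times
on the restriction of `σ` to all positions but the first `l` positions of `π`. -/
def SplitsUpperBounded (B : BettingStrategy) (π : ℕ → ℕ) (f : ℕ → ℝ) : Prop :=
  ∀ᵐ σ ∂coinMeasure, ∀ᶠ l in Filter.atTop, ∀ t x v, v ∈ B.ref.part t x → σ ∈ v →
    (splitCount B.ref (tailRestriction π l σ) x : ℝ) ≤ f l

end BettingStrategy

end GenBet

open scoped NNReal
open MeasureTheory

namespace GenBet

/-! Call the `2 ^ l` sequences that agree with `σ` off the first `l` positions of `π` the class of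
`σ`. A strategy that splits each part at most `K` times on a class tells apart only about `2 ^ K` of
its members, a small fraction of the class when `l - K` is large.

Take `C` above the sum of the initial masses. By Kolmogorov's inequality the closed set `V` on which
neither capital ever exceeds `C` has positive measure, and neither strategy wins on `V`. So a
non-random point of `V` suffices. By `exists_not_isMLRandom` it exists if, inside every cylinder
`[s]` meeting `V` in positive measure, uniformly enumerable sets of arbitrarily small measure
contain a cylinder that again meets `V` in positive measure: nest such cylinders and use
compactness.

The small set comes from a greedy selection of strings extending `s`. A string `τ` is accepted only
if, for each earlier selected `τ'`, every mate of `τ` in `[τ']` is already seen to be won (capital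
above `C`), and the path to the first won part found leaves `τ` at a part split at most `K` times on
the class.

The set is small (`card_selectedSet_inter_tail_cyl`): colour a selected member of a class by the
strategy for which it is first seen won. Members of one colour are pairwise separated within `K + 1`
splits of that strategy, so there are at most `2 ^ (K + 1)` of them, and at most one member is never
won. Averaging over classes gives measure at most `2 ^ (K + 3 - l)`.

The set is large enough (`exists_mem_selectedSet`): let `σ ∈ V ∩ [s]` lie only in parts split at
most `K` times on its class. If all selected members of the class were won, the paths to their won
parts would leave `σ` at parts containing `σ`, so a long prefix of `σ` would be accepted, although
`σ` is never won. Hence the class has a selected member in `V`. Flipping bits preserves measure, so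
positive measure passes to some selected cylinder. -/

/-! ### Prefixes, cylinders and finite unions of cylinders -/

/-- The prefix of length `n` of `σ`. -/
def pre (σ : BinSeq) (n : ℕ) : List Bool := (List.range n).map σ

@[simp] theorem length_pre (σ : BinSeq) (n : ℕ) : (pre σ n).length = n := by simp [pre]

@[simp] theorem getElem_pre (σ : BinSeq) (n i : ℕ) (h : i < (pre σ n).length) :
    (pre σ n)[i] = σ i := by simp [pre]

theorem mem_basicSet_iff_pre {σ : BinSeq} {s : List Bool} :
    σ ∈ basicSet s ↔ pre σ s.length = s := by
  constructor
  · intro h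
    exact List.ext_getElem (by simp) fun i h₁ h₂ => by simp [h i h₂]
  · intro h i hi
    have := getElem_pre σ s.length i (by simpa using hi)
    simp only [h] at this
    exact this.symm

theorem mem_basicSet_pre (σ : BinSeq) (n : ℕ) : σ ∈ basicSet (pre σ n) := by
  simp [mem_basicSet_iff_pre]

theorem pre_prefix_pre (σ : BinSeq) {m n : ℕ} (h : m ≤ n) : pre σ m <+: pre σ n := by
  obtain ⟨k, rfl⟩ := Nat.exists_eq_add_of_le h
  exact ⟨(List.range k).map (fun i => σ (m + i)), by simp [pre, List.range_add, Function.comp_def]⟩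

theorem prefix_pre_iff {σ : BinSeq} {s : List Bool} {n : ℕ} (h : s.length ≤ n) :
    s <+: pre σ n ↔ σ ∈ basicSet s := by
  rw [mem_basicSet_iff_pre]
  constructor
  · intro hs
    have := List.prefix_of_prefix_length_le hs (pre_prefix_pre σ h) (by simp)
    exact (this.eq_of_length (by simp)).symm
  · intro hs
    rw [← hs]
    exact pre_prefix_pre σ h

theorem mem_basicSet_of_prefix_pre {σ : BinSeq} {s : List Bool} {n : ℕ} (h : s <+: pre σ n) :
    σ ∈ basicSet s :=
  (prefix_pre_iff (by simpa using h.length_le)).1 h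

theorem basicSet_subset_of_prefix {s t : List Bool} (h : s <+: t) : basicSet t ⊆ basicSet s := by
  intro σ hσ
  rw [mem_basicSet_iff_pre] at hσ
  exact mem_basicSet_of_prefix_pre (hσ ▸ h)

theorem basicSet_nil : basicSet [] = Set.univ := by
  ext σ; simp [basicSet]

theorem isClopen_basicSet (s : List Bool) : IsClopen (basicSet s) := by
  have : basicSet s = ⋂ i : Fin s.length, (fun σ : BinSeq => σ i) ⁻¹' {s[i]} := by
    ext σ
    simp [basicSet, Fin.forall_iff]
  rw [this]
  exact isClopen_iInter_of_finite fun i => (isClopen_discrete _).preimage (continuous_apply _)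

theorem measurableSet_basicSet (s : List Bool) : MeasurableSet (basicSet s) :=
  (isClopen_basicSet s).isOpen.measurableSet

/-- The union of the basic sets of the strings in a finite list. -/
def unionSet (c : List (List Bool)) : Set BinSeq := ⋃ s ∈ c, basicSet s

theorem mem_unionSet {c : List (List Bool)} {σ : BinSeq} :
    σ ∈ unionSet c ↔ ∃ s ∈ c, σ ∈ basicSet s := by simp [unionSet]

/-- Some string in `c` is a prefix of `τ`. -/
def Covers (c : List (List Bool)) (τ : List Bool) : Prop := ∃ s ∈ c, s <+: τ

instance (c : List (List Bool)) (τ : List Bool) : Decidable (Covers c τ) :=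
  inferInstanceAs (Decidable (∃ s ∈ c, s <+: τ))

theorem mem_unionSet_of_covers {c : List (List Bool)} {σ : BinSeq} {n : ℕ}
    (h : Covers c (pre σ n)) : σ ∈ unionSet c :=
  let ⟨s, hs, hp⟩ := h
  mem_unionSet.2 ⟨s, hs, mem_basicSet_of_prefix_pre hp⟩

theorem covers_pre_iff {c : List (List Bool)} {σ : BinSeq} {n : ℕ} (h : ∀ s ∈ c, s.length ≤ n) :
    Covers c (pre σ n) ↔ σ ∈ unionSet c :=
  ⟨mem_unionSet_of_covers, fun hσ =>
    let ⟨s, hs, hm⟩ := mem_unionSet.1 hσ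
    ⟨s, hs, (prefix_pre_iff (h s hs)).2 hm⟩⟩

/-- All strings of length `n`. -/
def allStrings : ℕ → List (List Bool)
  | 0 => [[]]
  | n + 1 => (allStrings n).flatMap fun s => [s ++ [false], s ++ [true]]

theorem mem_allStrings {n : ℕ} {s : List Bool} : s ∈ allStrings n ↔ s.length = n := by
  induction n generalizing s with
  | zero => simp [allStrings]
  | succ n ih =>
    simp only [allStrings, List.mem_flatMap, ih]
    constructor
    · rintro ⟨t, rfl, h⟩
      simp only [List.mem_cons, List.not_mem_nil, or_false] at h
      rcases h with rfl | rfl <;> simp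
    · intro h
      have hne : s ≠ [] := by rintro rfl; simp at h
      refine ⟨s.dropLast, by simp [h], ?_⟩
      have := List.dropLast_append_getLast hne
      cases hl : s.getLast hne <;> rw [hl] at this <;> simp [this]

theorem nodup_allStrings (n : ℕ) : (allStrings n).Nodup := by
  induction n with
  | zero => simp [allStrings]
  | succ n ih =>
    rw [allStrings, List.nodup_flatMap]
    refine ⟨fun s _ => by simp, ih.imp fun {s t} h => ?_⟩
    simp only [Function.onFun, List.disjoint_left]
    intro x hx hx'
    simp only [List.mem_cons, List.not_mem_nil, or_false] at hx hx'
    apply h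
    rcases hx with rfl | rfl <;> rcases hx' with h | h <;> simp_all

theorem pre_mem_allStrings (σ : BinSeq) (n : ℕ) : pre σ n ∈ allStrings n := by
  simp [mem_allStrings]

/-! ### The coin-tossing measure -/

instance : IsProbabilityMeasure coinMeasure := by
  unfold coinMeasure; infer_instance

theorem coin_singleton (b : Bool) :
    (PMF.uniformOfFintype Bool).toMeasure {b} = 2⁻¹ := by
  rw [PMF.toMeasure_apply_singleton _ _ (measurableSet_singleton b)]
  simp

theorem coinMeasure_basicSet (s : List Bool) : coinMeasure (basicSet s) = 2⁻¹ ^ s.length := by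
  have : basicSet s =
      Set.pi (Finset.range s.length : Finset ℕ) fun i => {s.getD i false} := by
    ext σ
    simp only [basicSet, Set.mem_ofPred_eq, Set.mem_pi, Finset.coe_range, Set.mem_Iio,
      Set.mem_singleton_iff]
    exact ⟨fun h i hi => by simpa [hi] using h i hi, fun h i hi => by simpa [hi] using h i hi⟩
  rw [this, coinMeasure, Measure.infinitePi_pi _ fun _ _ => measurableSet_singleton _]
  simp only [coin_singleton, Finset.prod_const, Finset.card_range]

/-- Flip the bits of `σ` at the positions in `m`. -/
def flipAt (m : Finset ℕ) (σ : BinSeq) : BinSeq := fun i => xor (decide (i ∈ m)) (σ i)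

theorem flipAt_apply (m : Finset ℕ) (σ : BinSeq) (i : ℕ) :
    flipAt m σ i = xor (decide (i ∈ m)) (σ i) := rfl

/-- A negated fair bit is fair and the measure is a product. This symmetry moves measure between the
members of a class. -/
theorem measurePreserving_flipAt (m : Finset ℕ) :
    MeasurePreserving (flipAt m) coinMeasure coinMeasure := by
  have hmeas : ∀ i : ℕ, Measurable (xor (decide (i ∈ m))) := fun i => measurable_of_countable _
  refine ⟨measurable_pi_lambda _ fun i => (hmeas i).comp (measurable_pi_apply i), ?_⟩
  have := Measure.infinitePi_map_pi (fun _ : ℕ => (PMF.uniformOfFintype Bool).toMeasure)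
    (f := fun i => xor (decide (i ∈ m))) hmeas
  unfold coinMeasure
  refine Eq.trans this ?_
  congr 1
  funext i
  refine Measure.ext_of_singleton fun b => ?_
  rw [Measure.map_apply (hmeas i) (measurableSet_singleton b)]
  have : xor (decide (i ∈ m)) ⁻¹' {b} = {xor (decide (i ∈ m)) b} := by
    ext c
    cases decide (i ∈ m) <;> cases b <;> cases c <;> simp
  rw [this, coin_singleton, coin_singleton]

/-- The number of strings of length `n` that are compatible with some string in `c`. -/
def compatCount (n : ℕ) (c : List (List Bool)) : ℕ :=
  ((allStrings n).filter fun τ => ∃ s ∈ c, s <+: τ ∨ τ <+: s).length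

theorem coinMeasure_biUnion_filter (n : ℕ) (p : List Bool → Bool) :
    coinMeasure (⋃ τ ∈ (allStrings n).filter p, basicSet τ) =
      ((allStrings n).filter p).length * 2⁻¹ ^ n := by
  set L := (allStrings n).filter p
  have hL : ∀ τ ∈ L, τ.length = n := fun τ h => mem_allStrings.1 (List.mem_filter.1 h).1
  have hnd : L.Nodup := (nodup_allStrings n).filter p
  have : (⋃ τ ∈ L, basicSet τ) = ⋃ τ ∈ L.toFinset, basicSet τ := by simp
  rw [this, measure_biUnion_finset _ fun τ _ => measurableSet_basicSet τ]
  · rw [Finset.sum_congr rfl fun τ h => by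
      rw [coinMeasure_basicSet, hL τ (List.mem_toFinset.1 h)]]
    rw [Finset.sum_const, List.toFinset_card_of_nodup hnd, nsmul_eq_mul]
  · intro τ hτ τ' hτ' hne
    refine Set.disjoint_left.2 fun σ h h' => hne ?_
    rw [mem_basicSet_iff_pre, hL _ (by simpa using hτ)] at h
    rw [mem_basicSet_iff_pre, hL _ (by simpa using hτ')] at h'
    exact h.symm.trans h'

/-- When `n` is below the length of a string in `c`, the count also includes cylinders that are only
partly covered. An overestimate is the safe side when certifying that a capital is large. -/
theorem coinMeasure_unionSet_le (n : ℕ) (c : List (List Bool)) :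
    coinMeasure (unionSet c) ≤ compatCount n c * 2⁻¹ ^ n := by
  rw [compatCount, ← coinMeasure_biUnion_filter]
  refine measure_mono fun σ hσ => ?_
  obtain ⟨s, hs, h⟩ := mem_unionSet.1 hσ
  refine Set.mem_iUnion₂.2 ⟨pre σ n, ?_, mem_basicSet_pre σ n⟩
  simp only [List.mem_filter, pre_mem_allStrings, true_and, decide_eq_true_eq]
  refine ⟨s, hs, ?_⟩
  rcases le_total s.length n with hn | hn
  · exact Or.inl ((prefix_pre_iff hn).2 h)
  · rw [mem_basicSet_iff_pre] at h
    exact Or.inr (h ▸ pre_prefix_pre σ hn)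

theorem coinMeasure_unionSet_eq {n : ℕ} {c : List (List Bool)} (hc : ∀ s ∈ c, s.length ≤ n) :
    coinMeasure (unionSet c) = compatCount n c * 2⁻¹ ^ n := by
  refine le_antisymm (coinMeasure_unionSet_le n c) ?_
  rw [compatCount, ← coinMeasure_biUnion_filter]
  refine measure_mono (Set.iUnion₂_subset fun τ hτ => ?_)
  simp only [List.mem_filter, mem_allStrings, decide_eq_true_eq] at hτ
  obtain ⟨hl, s, hs, h⟩ := hτ
  have : s <+: τ := by
    rcases h with h | h
    · exact h
    · rw [h.eq_of_length_le (hl ▸ hc s hs)]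
  exact fun σ hσ => mem_unionSet.2 ⟨s, hs, basicSet_subset_of_prefix this hσ⟩

/-! ### Partition refinements -/

theorem exists_fork_of_not_prefix {x y : List Bool} (hxy : ¬ x <+: y) (hyx : ¬ y <+: x) :
    ∃ z b, z ++ [b] <+: x ∧ z ++ [!b] <+: y := by
  induction x generalizing y with
  | nil => exact absurd List.nil_prefix hxy
  | cons a x ih =>
    cases y with
    | nil => exact absurd List.nil_prefix hyx
    | cons c y =>
      by_cases hac : a = c
      · subst hac
        obtain ⟨z, b, h, h'⟩ := ih (by simpa using hxy) (by simpa using hyx)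
        exact ⟨a :: z, b, by simpa using h, by simpa using h'⟩
      · refine ⟨[], a, by simp, ?_⟩
        have : c = !a := by cases a <;> cases c <;> simp_all
        simp [this]

theorem exists_append_singleton_prefix {x y : List Bool} (h : x <+: y) (hne : x ≠ y) :
    ∃ b, x ++ [b] <+: y := by
  obtain ⟨t, rfl⟩ := h
  cases t with
  | nil => simp at hne
  | cons b t => exact ⟨b, t, by simp⟩

namespace PartitionRefinement

variable {Ω : Type} (S : PartitionRefinement Ω)

theorem dom_mono {t t' : ℕ} {x : List Bool} (h : t ≤ t') (hd : (S.part t x).Dom) :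
    (S.part t' x).Dom :=
  (S.persist t t' x _ h (Part.get_mem hd)).1

theorem partSet_eq {t : ℕ} {x : List Bool} {v : Set Ω} (hv : v ∈ S.part t x) :
    S.partSet x = v := by
  ext σ
  refine ⟨fun ⟨t', v', hv', hσ⟩ => ?_, fun hσ => ⟨t, v, hv, hσ⟩⟩
  have h₁ := S.persist t (max t t') x v (le_max_left _ _) hv
  have h₂ := S.persist t' (max t t') x v' (le_max_right _ _) hv'
  rwa [Part.mem_unique h₁ h₂]

variable {S}

theorem exists_mem_part {x : List Bool} (h : x ∈ S.coords) : ∃ t, S.partSet x ∈ S.part t x := by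
  obtain ⟨t, ht⟩ := h
  have := Part.get_mem ht
  exact ⟨t, (S.partSet_eq this).symm ▸ this⟩

theorem mem_coords_of_mem_partSet {x : List Bool} {σ : Ω} (h : σ ∈ S.partSet x) :
    x ∈ S.coords :=
  let ⟨t, _, hv, _⟩ := h
  ⟨t, hv.1⟩

theorem partSet_nonempty {x : List Bool} (h : x ∈ S.coords) : (S.partSet x).Nonempty :=
  let ⟨t, ht⟩ := exists_mem_part h
  S.part_nonempty t x _ ht

theorem child_dom' {t : ℕ} {x : List Bool} {b : Bool} (h : (S.part t (x ++ [b])).Dom) :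
    (S.part t x).Dom ∧ ∀ c, (S.part t (x ++ [c])).Dom := by
  obtain ⟨h', s, rfl, hs⟩ := S.child_dom t x b h
  refine ⟨S.dom_mono (Nat.le_succ s) hs, fun c => ?_⟩
  cases b <;> cases c <;> assumption

theorem dom_of_prefix {t : ℕ} {x y : List Bool} (hy : y <+: x) (h : (S.part t x).Dom) :
    (S.part t y).Dom := by
  induction x using List.reverseRecOn with
  | nil => rwa [List.prefix_nil.1 hy]
  | append_singleton x b ih =>
    rcases List.prefix_concat_iff.1 hy with rfl | hy
    · exact h
    · exact ih hy (child_dom' h).1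

theorem partSet_nil : S.partSet [] = Set.univ := S.partSet_eq S.root

theorem partSet_child {x : List Bool} {b : Bool} (h : x ++ [b] ∈ S.coords) :
    Disjoint (S.partSet (x ++ [b])) (S.partSet (x ++ [!b])) ∧
      S.partSet (x ++ [b]) ∪ S.partSet (x ++ [!b]) = S.partSet x := by
  obtain ⟨t, ht⟩ := h
  obtain ⟨h₀, h₁⟩ := child_dom' ht
  have key := S.child_partition t x _ _ _ (Part.get_mem h₀) (Part.get_mem (h₁ false))
    (Part.get_mem (h₁ true))
  rw [← S.partSet_eq (Part.get_mem h₀), ← S.partSet_eq (Part.get_mem (h₁ false)),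
    ← S.partSet_eq (Part.get_mem (h₁ true))] at key
  cases b
  · exact key
  · exact ⟨key.1.symm, by rw [Set.union_comm]; exact key.2⟩

theorem partSet_subset_of_prefix {x y : List Bool} (hy : y <+: x) :
    S.partSet x ⊆ S.partSet y := by
  induction x using List.reverseRecOn with
  | nil => rw [List.prefix_nil.1 hy]
  | append_singleton x b ih =>
    rcases List.prefix_concat_iff.1 hy with rfl | hy
    · exact subset_rfl
    · intro σ hσ
      refine ih hy ?_
      rw [← (partSet_child (mem_coords_of_mem_partSet hσ)).2]
      exact Or.inl hσ

theorem prefix_or_prefix_of_mem {x y : List Bool} {σ : Ω} (hx : σ ∈ S.partSet x)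
    (hy : σ ∈ S.partSet y) : x <+: y ∨ y <+: x := by
  by_contra! h
  obtain ⟨z, b, hz, hz'⟩ := exists_fork_of_not_prefix h.1 h.2
  have h₁ := partSet_subset_of_prefix hz hx
  exact Set.disjoint_left.1 (partSet_child (mem_coords_of_mem_partSet h₁)).1 h₁
    (partSet_subset_of_prefix hz' hy)

end PartitionRefinement

open PartitionRefinement

/-! ### Counting splits on a restriction -/

variable {S : PartitionRefinement BinSeq}

/-- Time drops out: just before the first moment at which the children are defined, the coordinate
is terminal, so a part with children is split at that moment. -/
theorem splitOn_iff {r : Restriction} {x : List Bool} {b : Bool} (h : x ++ [b] ∈ S.coords) :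
    SplitOn S r x ↔ (S.partSet (x ++ [b]) ∩ r.cyl).Nonempty ∧
      (S.partSet (x ++ [!b]) ∩ r.cyl).Nonempty := by
  have hsymm : ((S.partSet (x ++ [b]) ∩ r.cyl).Nonempty ∧
      (S.partSet (x ++ [!b]) ∩ r.cyl).Nonempty) ↔
      ((S.partSet (x ++ [false]) ∩ r.cyl).Nonempty ∧
        (S.partSet (x ++ [true]) ∩ r.cyl).Nonempty) := by
    cases b
    · rfl
    · exact and_comm
  rw [hsymm]
  constructor
  · rintro ⟨t, v₀, v₁, ⟨-, h₀, h₁⟩, hr⟩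
    rwa [S.partSet_eq h₀, S.partSet_eq h₁]
  · intro hr
    classical
    have ht : ∃ t, (S.part t (x ++ [b])).Dom := h
    have hd := child_dom' (Nat.find_spec ht)
    obtain ⟨-, s, hs, hsd⟩ := S.child_dom _ _ _ (Nat.find_spec ht)
    have hnot : ∀ c, ¬ (S.part s (x ++ [c])).Dom := fun c hc =>
      Nat.find_min ht (by omega) ((child_dom' hc).2 b)
    have h₀ := Part.get_mem (hd.2 false)
    have h₁ := Part.get_mem (hd.2 true)
    refine ⟨Nat.find ht, _, _, ⟨⟨s, hs, hsd, hnot _, hnot _⟩, h₀, h₁⟩, ?_⟩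
    rwa [← S.partSet_eq h₀, ← S.partSet_eq h₁]

theorem finite_setOf_splitOn (r : Restriction) (x : List Bool) :
    {y : List Bool | y <+: x ∧ y ≠ x ∧ SplitOn S r y}.Finite :=
  (List.finite_toSet x.inits).subset fun y hy => by simpa using hy.1

theorem splitCount_nil (r : Restriction) : splitCount S r [] = 0 := by
  rw [splitCount, Set.ncard_eq_zero (finite_setOf_splitOn r [])]
  ext y
  simp only [List.prefix_nil, Set.mem_ofPred_eq, Set.mem_empty_iff_false, iff_false]
  tauto

open Classical in
theorem splitCount_append_singleton (r : Restriction) (x : List Bool) (b : Bool) :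
    splitCount S r (x ++ [b]) = splitCount S r x + if SplitOn S r x then 1 else 0 := by
  have hx : ∀ {y : List Bool}, y <+: x → y ≠ x ++ [b] := by
    rintro _ h rfl
    simpa using h.length_le
  split_ifs with h
  · have : {y : List Bool | y <+: x ++ [b] ∧ y ≠ x ++ [b] ∧ SplitOn S r y} =
        insert x {y : List Bool | y <+: x ∧ y ≠ x ∧ SplitOn S r y} := by
      ext y
      simp only [List.prefix_concat_iff, Set.mem_insert_iff, Set.mem_ofPred_eq]
      constructor
      · rintro ⟨rfl | h₁, h₂, h₃⟩
        · exact absurd rfl h₂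
        · by_cases hy : y = x <;> tauto
      · rintro (rfl | ⟨h₁, h₂, h₃⟩)
        · exact ⟨Or.inr (List.prefix_refl _), hx (List.prefix_refl _), h⟩
        · exact ⟨Or.inr h₁, hx h₁, h₃⟩
    rw [splitCount, this, Set.ncard_insert_of_notMem (by simp) (finite_setOf_splitOn r x),
      splitCount]
  · rw [splitCount, splitCount, add_zero]
    congr 1
    ext y
    simp only [List.prefix_concat_iff, Set.mem_ofPred_eq]
    constructor
    · rintro ⟨rfl | h₁, h₂, h₃⟩
      · exact absurd rfl h₂
      · exact ⟨h₁, by rintro rfl; exact h h₃, h₃⟩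
    · rintro ⟨h₁, h₂, h₃⟩
      exact ⟨Or.inr h₁, hx h₁, h₃⟩

theorem splitCount_mono (r : Restriction) {x y : List Bool} (h : y <+: x) :
    splitCount S r y ≤ splitCount S r x := by
  refine Set.ncard_le_ncard (fun z hz => ?_) (finite_setOf_splitOn r x)
  refine ⟨hz.1.trans h, ?_, hz.2.2⟩
  rintro rfl
  exact hz.2.1 (hz.1.eq_of_length_le h.length_le)

theorem splitCount_lt (r : Restriction) {x y : List Bool} {b : Bool} (h : y ++ [b] <+: x)
    (hs : SplitOn S r y) : splitCount S r y < splitCount S r x := by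
  refine lt_of_lt_of_le ?_ (splitCount_mono r h)
  rw [splitCount_append_singleton, if_pos hs]
  exact Nat.lt_succ_self _

/-- The sequences `a` and `a'` lie in different children of some part that was split on `r` at
most `K` times. -/
def Separated (S : PartitionRefinement BinSeq) (r : Restriction) (K : ℕ) (a a' : BinSeq) : Prop :=
  ∃ y b, a ∈ S.partSet (y ++ [b]) ∧ a' ∈ S.partSet (y ++ [!b]) ∧ splitCount S r y ≤ K

theorem Separated.symm {r : Restriction} {K : ℕ} {a a' : BinSeq} (h : Separated S r K a a') :
    Separated S r K a' a :=
  let ⟨y, b, h₁, h₂, h₃⟩ := h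
  ⟨y, !b, h₂, by rwa [Bool.not_not], h₃⟩

/-- The parts containing `a` form a chain, and the count increases strictly past each part split on
`r`. So the count identifies the split that `a` goes through. -/
theorem eq_of_splitOn_of_mem {r : Restriction} {a : BinSeq} {y z : List Bool} {b c : Bool}
    (hy : SplitOn S r y) (hz : SplitOn S r z) (h : splitCount S r y = splitCount S r z)
    (hay : a ∈ S.partSet (y ++ [b])) (haz : a ∈ S.partSet (z ++ [c])) : y = z := by
  have key : ∀ {y z : List Bool} {b c : Bool}, SplitOn S r y →
      splitCount S r y = splitCount S r z → y ++ [b] <+: z ++ [c] → y = z := by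
    intro y z b c hy h hp
    rcases List.prefix_concat_iff.1 hp with hp | hp
    · exact (List.append_inj' hp rfl).1
    · exact absurd h (splitCount_lt r hp hy).ne
  rcases prefix_or_prefix_of_mem hay haz with hp | hp
  · exact key hy h hp
  · exact (key hz h.symm hp).symm

/-- Pairwise separated elements of `[r]` are determined by the directions they take at the first
`K + 1` splits on `r`. -/
theorem card_le_of_separated {r : Restriction} {K : ℕ} (T : Finset BinSeq)
    (hT : ∀ a ∈ T, a ∈ r.cyl)
    (hsep : ∀ a ∈ T, ∀ a' ∈ T, a ≠ a' → Separated S r K a a') : T.card ≤ 2 ^ (K + 1) := by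
  classical
  let dir : BinSeq → Fin (K + 1) → Bool := fun a i => decide (∃ y, SplitOn S r y ∧
    splitCount S r y = i ∧ a ∈ S.partSet (y ++ [true]))
  have hdir : ∀ {a a' : BinSeq}, a ∈ r.cyl → a' ∈ r.cyl → ∀ y, a ∈ S.partSet (y ++ [true]) →
      a' ∈ S.partSet (y ++ [false]) → splitCount S r y ≤ K → dir a ≠ dir a' := by
    intro a a' ha ha' y h h' hK heq
    -- Both sequences lie in `[r]`, so the part separating them is itself split on `r`.
    have hs : SplitOn S r y := (splitOn_iff (b := true) (mem_coords_of_mem_partSet h)).2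
      ⟨⟨a, h, ha⟩, ⟨a', h', ha'⟩⟩
    have h₁ := congrFun heq ⟨splitCount S r y, Nat.lt_succ_of_le hK⟩
    have h₂ : dir a ⟨splitCount S r y, Nat.lt_succ_of_le hK⟩ = true := by
      simp only [dir, decide_eq_true_eq]
      exact ⟨y, hs, rfl, h⟩
    rw [h₂] at h₁
    have h₃ := h₁.symm
    simp only [dir, decide_eq_true_eq] at h₃
    obtain ⟨z, hz, hzy, hm⟩ := h₃
    -- The split with this index at which `a'` would go to `true` must be `y`, where `a'` goes to
    -- `false`.
    obtain rfl := eq_of_splitOn_of_mem hz hs hzy hm h'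
    exact Set.disjoint_left.1 (partSet_child (mem_coords_of_mem_partSet hm)).1 hm h'
  have hinj : Set.InjOn dir T := by
    intro a ha a' ha' heq
    by_contra hne
    obtain ⟨y, b, h, h', hK⟩ := hsep a ha a' ha' hne
    cases b
    · exact hdir (hT a' ha') (hT a ha) y h' h hK heq.symm
    · exact hdir (hT a ha) (hT a' ha') y h h' hK heq
  calc T.card ≤ (Finset.univ : Finset (Fin (K + 1) → Bool)).card :=
        Finset.card_le_card_of_injOn dir (fun _ _ => Finset.mem_coe.2 (Finset.mem_univ _)) hinj
    _ = 2 ^ (K + 1) := by simp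

open PartitionRefinement

/-! ### The sequences that agree with a given one off finitely many positions -/

theorem mem_tail_cyl {π : ℕ → ℕ} {l : ℕ} {σ a : BinSeq} :
    a ∈ (tailRestriction π l σ).cyl ↔ ∀ p, (∀ i < l, π i ≠ p) → a p = σ p := by
  classical
  constructor
  · intro h p hp
    refine h p (σ p) ?_
    simp only [tailRestriction]
    rw [if_neg]
    rintro ⟨i, hi, rfl⟩
    exact hp i hi rfl
  · intro h p b hb
    simp only [tailRestriction] at hb
    split_ifs at hb with hp
    rw [h p fun i hi he => hp ⟨i, hi, he⟩]
    exact Option.some_injective _ hb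

theorem self_mem_tail_cyl (π : ℕ → ℕ) (l : ℕ) (σ : BinSeq) : σ ∈ (tailRestriction π l σ).cyl :=
  mem_tail_cyl.2 fun _ _ => rfl

theorem tailRestriction_eq {π : ℕ → ℕ} {l : ℕ} {σ a : BinSeq}
    (h : a ∈ (tailRestriction π l σ).cyl) : tailRestriction π l a = tailRestriction π l σ := by
  classical
  funext p
  simp only [tailRestriction]
  split_ifs with hp
  · rfl
  · rw [mem_tail_cyl.1 h p fun i hi he => hp ⟨i, hi, he⟩]

/-- The set of the first `l` positions of `π`. -/
def posSet (π : ℕ → ℕ) (l : ℕ) : Finset ℕ := (Finset.range l).image π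

/-- Presents a class as an orbit of finitely many measure-preserving maps. -/
theorem mem_tail_cyl_iff_flipAt {π : ℕ → ℕ} {l : ℕ} {σ a : BinSeq} :
    a ∈ (tailRestriction π l σ).cyl ↔ ∃ m ∈ (posSet π l).powerset, flipAt m σ = a := by
  rw [mem_tail_cyl]
  constructor
  · intro h
    refine ⟨(posSet π l).filter fun p => a p ≠ σ p, by simp, ?_⟩
    funext p
    by_cases hp : p ∈ posSet π l
    · simp only [flipAt_apply, Finset.mem_filter, hp, true_and]
      cases a p <;> cases σ p <;> simp
    · have : a p = σ p := h p fun i hi he => hp (by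
        simp only [posSet, Finset.mem_image, Finset.mem_range]; exact ⟨i, hi, he⟩)
      simp [flipAt_apply, hp, this]
  · rintro ⟨m, hm, rfl⟩ p hp
    have : p ∉ m := fun h => by
      have := Finset.mem_powerset.1 hm h
      simp only [posSet, Finset.mem_image, Finset.mem_range] at this
      obtain ⟨i, hi, rfl⟩ := this
      exact hp i hi rfl
    simp [flipAt_apply, this]

theorem finite_tail_cyl (π : ℕ → ℕ) (l : ℕ) (σ : BinSeq) :
    ((tailRestriction π l σ).cyl).Finite :=
  ((posSet π l).powerset.finite_toSet.image fun m => flipAt m σ).subset fun _ ha =>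
    mem_tail_cyl_iff_flipAt.1 ha

/-- The first `l` positions of `π`, as a list. -/
def posList (π : ℕ → ℕ) (l : ℕ) : List ℕ := (List.range l).map π

theorem mem_posList {π : ℕ → ℕ} {l p : ℕ} : p ∈ posList π l ↔ ∃ i < l, π i = p := by
  simp [posList]

/-- The strings of the same length as `τ` that agree with `τ` off the positions in `pos`. -/
def tailMates (pos : List ℕ) (τ : List Bool) : List (List Bool) :=
  (allStrings τ.length).filter fun ρ => ∀ i < τ.length, i ∈ pos ∨ ρ[i]? = τ[i]?

theorem mem_tailMates {π : ℕ → ℕ} {l n : ℕ} {σ : BinSeq} {ρ : List Bool} :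
    ρ ∈ tailMates (posList π l) (pre σ n) ↔
      ∃ a ∈ (tailRestriction π l σ).cyl, pre a n = ρ := by
  simp only [tailMates, length_pre, List.mem_filter, mem_allStrings, decide_eq_true_eq,
    mem_posList]
  constructor
  · rintro ⟨hl, h⟩
    refine ⟨fun i => ρ.getD i (σ i), mem_tail_cyl.2 fun p hp => ?_, ?_⟩
    · rcases lt_or_ge p n with hn | hn
      · rcases h p hn with ⟨i, hi, he⟩ | h
        · exact absurd he (hp i hi)
        · simp [h, hn]
      · simp [hl, hn]
    · refine List.ext_getElem (by simp [hl]) fun i h₁ h₂ => by simp [h₂]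
  · rintro ⟨a, ha, rfl⟩
    refine ⟨by simp, fun i hi => ?_⟩
    by_cases hp : ∃ j < l, π j = i
    · exact Or.inl hp
    · right
      have := mem_tail_cyl.1 ha i fun j hj he => hp ⟨j, hj, he⟩
      simp [hi, this]

/-! ### Paths in a partition refinement -/

/-- Finite descriptions of the parts met on the way to a part (deepest first): at each step, the
part entered and its sibling. -/
abbrev PathData : Type := List (List (List Bool) × List (List Bool))

/-- `P` describes the path to the coordinate `x`. -/
inductive IsPath (S : PartitionRefinement BinSeq) : List Bool → PathData → Prop
  | nil : IsPath S [] []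
  | snoc {x : List Bool} {b : Bool} {P : PathData} {c d : List (List Bool)} (hP : IsPath S x P)
      (hx : x ++ [b] ∈ S.coords) (hc : unionSet c = S.partSet (x ++ [b]))
      (hd : unionSet d = S.partSet (x ++ [!b])) : IsPath S (x ++ [b]) ((c, d) :: P)

/-- All strings in the description have length at most `n`. -/
def PathData.SizeLE (P : PathData) (n : ℕ) : Prop :=
  ∀ q ∈ P, (∀ s ∈ q.1, s.length ≤ n) ∧ ∀ s ∈ q.2, s.length ≤ n

/-- The union of the basic sets in `c` meets the set of tail mates of `τ`. -/
def Meets (pos : List ℕ) (τ : List Bool) (c : List (List Bool)) : Prop :=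
  ∃ ρ ∈ tailMates pos τ, Covers c ρ

instance (pos : List ℕ) (τ : List Bool) (c : List (List Bool)) : Decidable (Meets pos τ c) :=
  inferInstanceAs (Decidable (∃ ρ ∈ tailMates pos τ, Covers c ρ))

/-- The number of splits on the tail mates of `τ` along a path. -/
def pathSplits (pos : List ℕ) (τ : List Bool) (P : PathData) : ℕ :=
  (P.filter fun q => Meets pos τ q.1 ∧ Meets pos τ q.2).length

/-- The path leaves `τ` at a part that was split at most `K` times on the tail mates of `τ`. -/
def Leaves (K : ℕ) (pos : List ℕ) (τ : List Bool) (P : PathData) : Prop :=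
  ∃ i < P.length, (∃ q ∈ (P.drop i).take 1, Covers q.2 τ) ∧
    pathSplits pos τ (P.drop (i + 1)) ≤ K

instance (K : ℕ) (pos : List ℕ) (τ : List Bool) (P : PathData) :
    Decidable (Leaves K pos τ P) :=
  inferInstanceAs (Decidable (∃ i < P.length, (∃ q ∈ (P.drop i).take 1, Covers q.2 τ) ∧
    pathSplits pos τ (P.drop (i + 1)) ≤ K))

theorem meets_pre_iff {π : ℕ → ℕ} {l n : ℕ} {σ : BinSeq} {c : List (List Bool)}
    (hc : ∀ s ∈ c, s.length ≤ n) :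
    Meets (posList π l) (pre σ n) c ↔ (unionSet c ∩ (tailRestriction π l σ).cyl).Nonempty := by
  constructor
  · rintro ⟨ρ, hρ, h⟩
    obtain ⟨a, ha, rfl⟩ := mem_tailMates.1 hρ
    exact ⟨a, mem_unionSet_of_covers h, ha⟩
  · rintro ⟨a, h, ha⟩
    exact ⟨pre a n, mem_tailMates.2 ⟨a, ha, rfl⟩, (covers_pre_iff hc).2 h⟩

/-! ### What path data say about splits and separation -/

section Path

variable {S : PartitionRefinement BinSeq} {x : List Bool} {P : PathData} {π : ℕ → ℕ} {l n K : ℕ}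

theorem pathSplits_eq_splitCount {a : BinSeq} (h : IsPath S x P) (hP : P.SizeLE n) :
    pathSplits (posList π l) (pre a n) P = splitCount S (tailRestriction π l a) x := by
  induction h with
  | nil => rw [splitCount_nil]; rfl
  | @snoc x b P c d hx hb hc hd ih =>
    have ih := ih fun q hq => hP q (List.mem_cons_of_mem _ hq)
    have hs := hP (c, d) List.mem_cons_self
    have hiff : (Meets (posList π l) (pre a n) c ∧ Meets (posList π l) (pre a n) d) ↔
        SplitOn S (tailRestriction π l a) x := by
      rw [splitOn_iff hb, meets_pre_iff hs.1, meets_pre_iff hs.2, hc, hd]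
    rw [splitCount_append_singleton, ← ih, pathSplits, List.filter_cons]
    by_cases h : SplitOn S (tailRestriction π l a) x
    · rw [if_pos (decide_eq_true (hiff.2 h)), if_pos h]; rfl
    · rw [if_neg (fun h' => h (hiff.1 (of_decide_eq_true h'))), if_neg h]; rfl

theorem IsPath.drop {i : ℕ} {c d : List (List Bool)} {Q : PathData} (h : IsPath S x P)
    (hP : P.drop i = (c, d) :: Q) : ∃ y b, y ++ [b] <+: x ∧ IsPath S y Q ∧
      unionSet c = S.partSet (y ++ [b]) ∧ unionSet d = S.partSet (y ++ [!b]) := by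
  induction h generalizing i with
  | nil => simp at hP
  | @snoc x b P c' d' hx hb hc hd ih =>
    cases i with
    | zero =>
      simp only [List.drop_zero, List.cons.injEq, Prod.mk.injEq] at hP
      obtain ⟨⟨rfl, rfl⟩, rfl⟩ := hP
      exact ⟨x, b, List.prefix_refl _, hx, hc, hd⟩
    | succ i =>
      obtain ⟨y, b', hy, h⟩ := ih hP
      exact ⟨y, b', hy.trans (List.prefix_append _ _), h⟩

theorem Leaves.separated {a a' : BinSeq} (h : IsPath S x P) (hP : P.SizeLE n)
    (hL : Leaves K (posList π l) (pre a n) P) (ha' : a' ∈ S.partSet x) :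
    Separated S (tailRestriction π l a) K a' a := by
  obtain ⟨i, hi, ⟨q, hq, hcov⟩, hK⟩ := hL
  rw [List.drop_eq_getElem_cons hi] at hq
  simp only [List.take_succ_cons, List.take_zero, List.mem_singleton] at hq
  subst hq
  obtain ⟨y, b, hy, hQ, hc, hd⟩ := h.drop (i := i) (List.drop_eq_getElem_cons hi)
  rw [pathSplits_eq_splitCount hQ fun q hq => hP q (List.mem_of_mem_drop hq)] at hK
  exact ⟨y, b, partSet_subset_of_prefix hy ha', hd ▸ mem_unionSet_of_covers hcov, hK⟩

/-- The path starts at the whole space, so it has a last part containing `a`. It leaves `a` there,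
and the bound `hK` applies to that part. -/
theorem leaves_of_notMem {a : BinSeq} (h : IsPath S x P) (hP : P.SizeLE n)
    (ha : a ∉ S.partSet x)
    (hK : ∀ y, a ∈ S.partSet y → splitCount S (tailRestriction π l a) y ≤ K) :
    Leaves K (posList π l) (pre a n) P := by
  induction h with
  | nil => simp [partSet_nil] at ha
  | @snoc x b P c d hx hb hc hd ih =>
    have hP' : PathData.SizeLE P n := fun q hq => hP q (List.mem_cons_of_mem _ hq)
    by_cases hax : a ∈ S.partSet x
    · have had : a ∈ S.partSet (x ++ [!b]) := by
        rw [← (partSet_child hb).2] at hax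
        exact hax.resolve_left ha
      -- Path data are listed deepest first, so index `0` is the last step of the path.
      refine ⟨0, by simp, ⟨(c, d), by simp, ?_⟩, ?_⟩
      · exact (covers_pre_iff (hP (c, d) List.mem_cons_self).2).2 (hd ▸ had)
      · simp only [zero_add, List.drop_succ_cons, List.drop_zero]
        rw [pathSplits_eq_splitCount hx hP']
        exact hK x hax
    · obtain ⟨i, hi, h₁, h₂⟩ := ih hP' hax
      exact ⟨i + 1, by simpa using hi, by simpa using h₁, by simpa using h₂⟩

end Path

/-! ### The greedy selection of strings -/

/-- A description of a part on which a strategy won: which strategy, the part, and its path. -/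
abbrev Item : Type := Bool × List (List Bool) × PathData

/-- The first item of the list that covers `ρ`, as a list with at most one element. -/
def firstCovering (items : List Item) (ρ : List Bool) : List Item :=
  (items.filter fun it => Covers it.2.1 ρ).take 1

/-- `τ` may be selected after `τ'`: every tail mate of `τ` in `[τ']` has been won, and the path
to the first part on which it was won leaves `τ` after at most `K` splits. -/
def Compatible (K : ℕ) (pos : List ℕ) (items : List Item) (τ τ' : List Bool) : Prop :=
  τ'.length ≤ τ.length ∧ ∀ ρ ∈ tailMates pos τ, τ' <+: ρ →
    ∃ it ∈ firstCovering items ρ, Leaves K pos τ it.2.2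

instance (K : ℕ) (pos : List ℕ) (items : List Item) (τ τ' : List Bool) :
    Decidable (Compatible K pos items τ τ') :=
  inferInstanceAs (Decidable (_ ∧ ∀ ρ ∈ tailMates pos τ, τ' <+: ρ →
    ∃ it ∈ firstCovering items ρ, Leaves K pos τ it.2.2))

/-- `τ` is selected when the strings in `prev` have been selected before. -/
def Selectable (s : List Bool) (K : ℕ) (pos : List ℕ) (items : List Item) (prev : List (List Bool))
    (τ : List Bool) : Prop :=
  s <+: τ ∧ (∀ p ∈ pos, p < τ.length) ∧ ∀ τ' ∈ prev, Compatible K pos items τ τ'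

instance (s : List Bool) (K : ℕ) (pos : List ℕ) (items : List Item) (prev : List (List Bool))
    (τ : List Bool) : Decidable (Selectable s K pos items prev τ) :=
  inferInstanceAs (Decidable (_ ∧ _ ∧ _))

/-- Select strings of length `n` one after the other. -/
def selectLevel (s : List Bool) (K : ℕ) (pos : List ℕ) (items : List Item) (n : ℕ)
    (prev : List (List Bool)) : List (List Bool) :=
  (allStrings n).foldl
    (fun prev τ => if Selectable s K pos items prev τ then τ :: prev else prev) prev

/-- The items enumerated before stage `n`. -/
def itemsBelow (item : ℕ → Option Item) (n : ℕ) : List Item := (List.range n).filterMap item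

/-- The strings of length less than `n` that are selected, the latest first. -/
def selected (item : ℕ → Option Item) (s : List Bool) (K : ℕ) (pos : List ℕ) :
    ℕ → List (List Bool)
  | 0 => []
  | n + 1 => selectLevel s K pos (itemsBelow item n) n (selected item s K pos n)

/-- The enumeration `item` lists exactly the coordinates in `won`. -/
structure Enumerates (S : Bool → PartitionRefinement BinSeq) (won : Bool → Set (List Bool))
    (item : ℕ → Option Item) : Prop where
  size_part : ∀ j it, item j = some it → ∀ s ∈ it.2.1, s.length ≤ j
  size_path : ∀ j it, item j = some it → it.2.2.SizeLE j
  sound : ∀ j it, item j = some it → ∃ x ∈ won it.1,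
    IsPath (S it.1) x it.2.2 ∧ unionSet it.2.1 = (S it.1).partSet x
  complete : ∀ fl, ∀ x ∈ won fl, ∃ j it, item j = some it ∧ unionSet it.2.1 = (S fl).partSet x

/-! ### Properties of the greedy selection -/

section Selection

variable {S : Bool → PartitionRefinement BinSeq} {won : Bool → Set (List Bool)}
  {item : ℕ → Option Item} {s : List Bool} {K l : ℕ} {pos : List ℕ} {π : ℕ → ℕ}

/-- An element is rejected because of the list held at its turn. That list only grows, so whatever
blocked the element is still present at the end. -/
theorem mem_foldl_select {α : Type*} (p : List α → α → Prop) [∀ L, DecidablePred (p L)]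
    (L prev : List α) :
    (∃ t, L.foldl (fun prev τ => if p prev τ then τ :: prev else prev) prev = t ++ prev ∧ t ⊆ L) ∧
    ∀ τ ∈ L, τ ∈ L.foldl (fun prev τ => if p prev τ then τ :: prev else prev) prev ∨
      ∃ prev', prev' ⊆ L.foldl (fun prev τ => if p prev τ then τ :: prev else prev) prev ∧
        ¬ p prev' τ := by
  induction L generalizing prev with
  | nil => exact ⟨⟨[], by simp⟩, by simp⟩
  | cons a L ih =>
    simp only [List.foldl_cons]
    split_ifs with h
    · obtain ⟨⟨t, ht, htL⟩, h₂⟩ := ih (a :: prev)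
      refine ⟨⟨t ++ [a], by simp [ht], ?_⟩, ?_⟩
      · intro z hz
        rcases List.mem_append.1 hz with hz | hz
        · exact List.mem_cons_of_mem _ (htL hz)
        · rw [List.mem_singleton.1 hz]; exact List.mem_cons_self
      · intro τ hτ
        rcases List.mem_cons.1 hτ with rfl | hτ
        · left; rw [ht]; simp
        · exact h₂ τ hτ
    · obtain ⟨⟨t, ht, htL⟩, h₂⟩ := ih prev
      refine ⟨⟨t, ht, fun z hz => List.mem_cons_of_mem _ (htL hz)⟩, fun τ hτ => ?_⟩
      rcases List.mem_cons.1 hτ with rfl | hτ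
      · right
        exact ⟨prev, by rw [ht]; simp, h⟩
      · exact h₂ τ hτ

theorem foldl_select_induction {α : Type*} (p : List α → α → Prop) [∀ L, DecidablePred (p L)]
    (Q : List α → Prop) (L prev : List α) (h₀ : Q prev)
    (h : ∀ M, ∀ τ ∈ L, Q M → p M τ → Q (τ :: M)) :
    Q (L.foldl (fun prev τ => if p prev τ then τ :: prev else prev) prev) := by
  induction L generalizing prev with
  | nil => exact h₀
  | cons a L ih =>
    simp only [List.foldl_cons]
    split_ifs with ha
    · exact ih _ (h _ _ List.mem_cons_self h₀ ha) fun M τ hτ => h M τ (List.mem_cons_of_mem _ hτ)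
    · exact ih _ h₀ fun M τ hτ => h M τ (List.mem_cons_of_mem _ hτ)

theorem selected_induction {Q : List (List Bool) → Prop} (h₀ : Q [])
    (h : ∀ M τ, Q M → Selectable s K pos (itemsBelow item τ.length) M τ → Q (τ :: M)) (n : ℕ) :
    Q (selected item s K pos n) := by
  induction n with
  | zero => exact h₀
  | succ n ih =>
    refine foldl_select_induction _ Q _ _ ih fun M τ hτ hM hs => h M τ hM ?_
    rwa [mem_allStrings.1 hτ]

theorem selected_subset {m n : ℕ} (h : m ≤ n) :
    selected item s K pos m ⊆ selected item s K pos n := by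
  induction n, h using Nat.le_induction with
  | base => exact List.Subset.refl _
  | succ n _ ih =>
    obtain ⟨⟨t, ht, -⟩, -⟩ := mem_foldl_select
      (fun prev τ => Selectable s K pos (itemsBelow item n) prev τ) (allStrings n)
      (selected item s K pos n)
    rw [selected, selectLevel, ht]
    exact List.Subset.trans ih (List.subset_append_right _ _)

theorem length_lt_of_mem_selected {n : ℕ} {τ : List Bool} (h : τ ∈ selected item s K pos n) :
    τ.length < n := by
  induction n with
  | zero => simp [selected] at h
  | succ n ih =>
    obtain ⟨⟨t, ht, htL⟩, -⟩ := mem_foldl_select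
      (fun prev τ => Selectable s K pos (itemsBelow item n) prev τ) (allStrings n)
      (selected item s K pos n)
    rw [selected, selectLevel, ht] at h
    rcases List.mem_append.1 h with h | h
    · have := mem_allStrings.1 (htL h)
      omega
    · have := ih h
      omega

theorem prefix_of_mem_selected {n : ℕ} {τ : List Bool} (h : τ ∈ selected item s K pos n) :
    s <+: τ ∧ ∀ p ∈ pos, p < τ.length := by
  refine selected_induction (Q := fun L => ∀ τ ∈ L, s <+: τ ∧ ∀ p ∈ pos, p < τ.length) (by simp)
    (fun M τ hM hs τ' hτ' => ?_) n τ h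
  rcases List.mem_cons.1 hτ' with rfl | hτ'
  · exact ⟨hs.1, hs.2.1⟩
  · exact hM τ' hτ'

theorem pairwise_selected (n : ℕ) : (selected item s K pos n).Pairwise fun τ τ' =>
    Compatible K pos (itemsBelow item τ.length) τ τ' :=
  selected_induction (Q := fun L => L.Pairwise fun τ τ' =>
    Compatible K pos (itemsBelow item τ.length) τ τ') List.Pairwise.nil
    (fun _ _ hM hs => List.Pairwise.cons (R := fun τ τ' =>
      Compatible K pos (itemsBelow item τ.length) τ τ') hs.2.2 hM) n

theorem mem_selected_or {τ : List Bool} (hs : s <+: τ) (hpos : ∀ p ∈ pos, p < τ.length) :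
    τ ∈ selected item s K pos (τ.length + 1) ∨
      ∃ τ' ∈ selected item s K pos (τ.length + 1),
        ¬ Compatible K pos (itemsBelow item τ.length) τ τ' := by
  obtain ⟨-, h⟩ := mem_foldl_select
    (fun prev τ' => Selectable s K pos (itemsBelow item τ.length) prev τ') (allStrings τ.length)
    (selected item s K pos τ.length)
  rcases h τ (mem_allStrings.2 rfl) with h | ⟨prev, hsub, hn⟩
  · exact Or.inl h
  · right
    simp only [Selectable, not_and] at hn
    have := hn hs hpos
    push Not at this
    obtain ⟨τ', h', hc⟩ := this
    exact ⟨τ', hsub h', hc⟩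

/-- The set of sequences covered by the selected strings. -/
def selectedSet (item : ℕ → Option Item) (s : List Bool) (K : ℕ) (pos : List ℕ) : Set BinSeq :=
  ⋃ n, ⋃ τ ∈ selected item s K pos n, basicSet τ

theorem mem_selectedSet {a : BinSeq} : a ∈ selectedSet item s K pos ↔
    ∃ n, ∃ τ ∈ selected item s K pos n, a ∈ basicSet τ := by
  simp [selectedSet]

/-- The first part in the enumeration that contains `a` is described by `it`. -/
def IsFirst (item : ℕ → Option Item) (a : BinSeq) (it : Item) : Prop :=
  ∃ j, item j = some it ∧ a ∈ unionSet it.2.1 ∧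
    ∀ j' < j, ∀ it', item j' = some it' → a ∉ unionSet it'.2.1

theorem IsFirst.unique {a : BinSeq} {it it' : Item} (h : IsFirst item a it)
    (h' : IsFirst item a it') : it = it' := by
  obtain ⟨j, hj, ha, hm⟩ := h
  obtain ⟨j', hj', ha', hm'⟩ := h'
  rcases lt_trichotomy j j' with hlt | rfl | hlt
  · exact absurd ha (hm' j hlt _ hj)
  · exact Option.some_injective _ (hj.symm.trans hj')
  · exact absurd ha' (hm j' hlt _ hj')

/-- The strings of item `j` have length at most `j`, so a prefix of length `n > j` decides
membership exactly. The bounded search therefore finds the true first part, and later stages never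
change the colour of `a`. -/
theorem isFirst_of_mem_firstCovering (hE : Enumerates S won item) {a : BinSeq} {n : ℕ} {it : Item}
    (h : it ∈ firstCovering (itemsBelow item n) (pre a n)) :
    ∃ j < n, item j = some it ∧ IsFirst item a it := by
  have key : ∀ m ≤ n, it ∈ firstCovering (itemsBelow item m) (pre a n) →
      ∃ j < m, item j = some it ∧ IsFirst item a it := by
    intro m
    induction m with
    | zero => intro _ h; simp [firstCovering, itemsBelow] at h
    | succ m ih =>
      intro hm h
      rw [firstCovering, itemsBelow, List.range_succ, List.filterMap_append, List.filter_append,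
        List.take_append, List.mem_append] at h
      rcases h with h | h
      · obtain ⟨j, hj, h⟩ := ih (by omega) h
        exact ⟨j, by omega, h⟩
      -- `take 1` reaches the new item only if no earlier one covers the prefix.
      · have hnil : (itemsBelow item m).filter (fun it => Covers it.2.1 (pre a n)) = [] := by
          by_contra hne
          have : 1 - ((itemsBelow item m).filter
              (fun it => decide (Covers it.2.1 (pre a n)))).length = 0 := by
            have := List.length_pos_iff.2 hne
            omega
          rw [itemsBelow] at this
          rw [this] at h
          simp at h
        have h := List.mem_of_mem_take h
        simp only [List.mem_filter, List.mem_filterMap, List.mem_singleton, exists_eq_left,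
          decide_eq_true_eq] at h
        refine ⟨m, by omega, h.1, m, h.1, mem_unionSet_of_covers h.2, fun j' hj' it' hit' ha => ?_⟩
        have hmem : it' ∈ (itemsBelow item m).filter (fun it => Covers it.2.1 (pre a n)) := by
          simp only [List.mem_filter, itemsBelow, List.mem_filterMap, List.mem_range,
            decide_eq_true_eq]
          refine ⟨⟨j', hj', hit'⟩, (covers_pre_iff fun s hs => ?_).2 ha⟩
          exact (hE.size_part j' it' hit' s hs).trans (by omega)
        rw [hnil] at hmem
        simp at hmem
  exact key n le_rfl h

/-- All free positions lie inside `τ`, so a selected cylinder holds at most one member of a class.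
-/
theorem eq_of_mem_basicSet_of_mem_tail_cyl {τ : List Bool} {σ a a' : BinSeq}
    (hpos : ∀ p ∈ posList π l, p < τ.length) (ha : a ∈ basicSet τ) (ha' : a' ∈ basicSet τ)
    (hc : a ∈ (tailRestriction π l σ).cyl) (hc' : a' ∈ (tailRestriction π l σ).cyl) : a = a' := by
  funext p
  by_cases hp : ∃ i < l, π i = p
  · have hlt := hpos p (mem_posList.2 hp)
    rw [ha p hlt, ha' p hlt]
  · push Not at hp
    rw [mem_tail_cyl.1 hc p hp, mem_tail_cyl.1 hc' p hp]

/-- The separating strategy is `it.1`, the one that determines the colour of `a'`. This makes the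
count by colours possible. -/
theorem isFirst_and_separated (hE : Enumerates S won item) {τ τ' : List Bool} {σ a a' : BinSeq}
    (h : Compatible K (posList π l) (itemsBelow item τ.length) τ τ') (ha : a ∈ basicSet τ)
    (ha' : a' ∈ basicSet τ') (hc : a ∈ (tailRestriction π l σ).cyl)
    (hc' : a' ∈ (tailRestriction π l σ).cyl) :
    ∃ it, IsFirst item a' it ∧ Separated (S it.1) (tailRestriction π l σ) K a' a := by
  obtain ⟨hle, h⟩ := h
  rw [mem_basicSet_iff_pre] at ha
  rw [← tailRestriction_eq hc] at hc'
  have hmate : pre a' τ.length ∈ tailMates (posList π l) (pre a τ.length) :=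
    mem_tailMates.2 ⟨a', hc', rfl⟩
  rw [ha] at hmate
  obtain ⟨it, hit, hL⟩ := h (pre a' τ.length) hmate ((prefix_pre_iff hle).2 ha')
  obtain ⟨j, hj, hji, hf⟩ := isFirst_of_mem_firstCovering hE hit
  refine ⟨it, hf, ?_⟩
  obtain ⟨x, -, hx, hcx⟩ := hE.sound j it hji
  obtain ⟨-, -, hmem, -⟩ := hf
  rw [← tailRestriction_eq hc]
  rw [← ha] at hL
  exact Leaves.separated hx (fun q hq => ⟨fun s hs => ((hE.size_path j it hji q hq).1 s hs).trans
    hj.le, fun s hs => ((hE.size_path j it hji q hq).2 s hs).trans hj.le⟩) hL (hcx ▸ hmem)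

/-- Few members of each class are covered by the selected strings. -/
theorem card_selectedSet_inter_tail_cyl (hE : Enumerates S won item) (σ : BinSeq)
    (T : Finset BinSeq) (hT : ∀ a ∈ T, a ∈ (tailRestriction π l σ).cyl)
    (hTs : ∀ a ∈ T, a ∈ selectedSet item s K (posList π l)) : T.card ≤ 2 ^ (K + 3) := by
  classical
  have key : ∀ a ∈ T, ∀ a' ∈ T, a ≠ a' →
      (∃ it, IsFirst item a it ∧ Separated (S it.1) (tailRestriction π l σ) K a a') ∨
      ∃ it, IsFirst item a' it ∧ Separated (S it.1) (tailRestriction π l σ) K a' a := by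
    intro a ha a' ha' hne
    obtain ⟨n, τ, hτ, haτ⟩ := mem_selectedSet.1 (hTs a ha)
    obtain ⟨n', τ', hτ', haτ'⟩ := mem_selectedSet.1 (hTs a' ha')
    have h₁ := selected_subset (le_max_left n n') hτ
    have h₂ := selected_subset (le_max_right n n') hτ'
    have hττ : τ ≠ τ' := by
      rintro rfl
      exact hne (eq_of_mem_basicSet_of_mem_tail_cyl (prefix_of_mem_selected hτ).2 haτ haτ'
        (hT a ha) (hT a' ha'))
    have hp := (pairwise_selected (item := item) (s := s) (K := K) (pos := posList π l)
      (max n n')).imp (S := fun τ τ' =>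
        Compatible K (posList π l) (itemsBelow item τ.length) τ τ' ∨
        Compatible K (posList π l) (itemsBelow item τ'.length) τ' τ) fun h => Or.inl h
    have : Std.Symm fun τ τ' => Compatible K (posList π l) (itemsBelow item τ.length) τ τ' ∨
        Compatible K (posList π l) (itemsBelow item τ'.length) τ' τ := ⟨fun _ _ h => Or.symm h⟩
    rcases hp.forall h₁ h₂ hττ with h | h
    · exact Or.inr (isFirst_and_separated hE h haτ haτ' (hT a ha) (hT a' ha'))
    · exact Or.inl (isFirst_and_separated hE h haτ' haτ (hT a' ha') (hT a ha))
  -- Whichever of two members supplies the separation, it does so in its own colour, so one colour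
  -- needs only one refinement.
  have hcol : ∀ fl, (T.filter fun a => ∃ it, IsFirst item a it ∧ it.1 = fl).card ≤ 2 ^ (K + 1) := by
    intro fl
    refine card_le_of_separated (S := S fl) _ (fun a ha => hT a (Finset.mem_filter.1 ha).1) ?_
    intro a ha a' ha' hne
    obtain ⟨haT, it, hit, rfl⟩ := Finset.mem_filter.1 ha
    obtain ⟨haT', it', hit', hfl⟩ := Finset.mem_filter.1 ha'
    rcases key a haT a' haT' hne with ⟨it₁, h₁, h₂⟩ | ⟨it₁, h₁, h₂⟩
    · rwa [← hit.unique h₁] at h₂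
    · rw [← hit'.unique h₁, hfl] at h₂
      exact h₂.symm
  -- Of two selected members, one must already have been won when the other was accepted.
  have hnone : (T.filter fun a => ¬ ∃ it, IsFirst item a it).card ≤ 1 := by
    refine Finset.card_le_one.2 fun a ha a' ha' => ?_
    by_contra hne
    rw [Finset.mem_filter] at ha ha'
    rcases key a ha.1 a' ha'.1 hne with ⟨it, h, -⟩ | ⟨it, h, -⟩
    · exact ha.2 ⟨it, h⟩
    · exact ha'.2 ⟨it, h⟩
  have hcover : T ⊆ ((T.filter fun a => ∃ it, IsFirst item a it ∧ it.1 = false) ∪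
      T.filter fun a => ∃ it, IsFirst item a it ∧ it.1 = true) ∪
      T.filter fun a => ¬ ∃ it, IsFirst item a it := by
    intro a ha
    simp only [Finset.mem_union, Finset.mem_filter, ha, true_and]
    by_cases h : ∃ it, IsFirst item a it
    · obtain ⟨it, hit⟩ := h
      left
      cases hfl : it.1
      · exact Or.inl ⟨it, hit, hfl⟩
      · exact Or.inr ⟨it, hit, hfl⟩
    · exact Or.inr h
  have h₁ := Finset.card_le_card hcover
  have h₂ := Finset.card_union_le ((T.filter fun a => ∃ it, IsFirst item a it ∧ it.1 = false) ∪
      T.filter fun a => ∃ it, IsFirst item a it ∧ it.1 = true)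
      (T.filter fun a => ¬ ∃ it, IsFirst item a it)
  have h₃ := Finset.card_union_le (T.filter fun a => ∃ it, IsFirst item a it ∧ it.1 = false)
      (T.filter fun a => ∃ it, IsFirst item a it ∧ it.1 = true)
  have h₄ := hcol false
  have h₅ := hcol true
  -- The total is at most `2 * 2 ^ (K + 1) + 1`, which is below `2 ^ (K + 3)`.
  have h₆ : 1 ≤ 2 ^ (K + 1) := Nat.one_le_two_pow
  have h₇ : 2 ^ (K + 3) = 2 ^ (K + 1) * 4 := by ring
  omega

/-- If a sequence in `[s]` is never won and all parts containing it are split at most `K` times,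
then the selected strings cover a member of its class that is never won. -/
theorem exists_mem_selectedSet (hE : Enumerates S won item) {σ : BinSeq} (hσ : σ ∈ basicSet s)
    (hnw : ∀ fl, ∀ x ∈ won fl, σ ∉ (S fl).partSet x)
    (hK : ∀ fl y, σ ∈ (S fl).partSet y → splitCount (S fl) (tailRestriction π l σ) y ≤ K) :
    ∃ a ∈ (tailRestriction π l σ).cyl, a ∈ selectedSet item s K (posList π l) ∧
      ∀ fl, ∀ x ∈ won fl, a ∉ (S fl).partSet x := by
  by_contra! hcon
  have hJ : ∀ a ∈ (tailRestriction π l σ).cyl, ∃ j,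
      a ∈ selectedSet item s K (posList π l) → ∃ it, item j = some it ∧ a ∈ unionSet it.2.1 := by
    intro a ha
    by_cases has : a ∈ selectedSet item s K (posList π l)
    · obtain ⟨fl, x, hx, hax⟩ := hcon a ha has
      obtain ⟨j, it, hj, hit⟩ := hE.complete fl x hx
      exact ⟨j, fun _ => ⟨it, hj, hit ▸ hax⟩⟩
    · exact ⟨0, fun h => absurd h has⟩
  choose! J hJ using hJ
  obtain ⟨N, hN⟩ := ((finite_tail_cyl π l σ).image J).bddAbove
  obtain ⟨M, hM⟩ := (posList π l).toFinset.bddAbove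
  -- The class is finite, so one length suffices to see the wins of all its selected members; it
  -- also exceeds every free position and reaches the length of `s`.
  set n := max (max (N + 1) (M + 1)) s.length with hn
  have hlen : (pre σ n).length = n := by simp
  have hself := self_mem_tail_cyl π l σ
  rcases mem_selected_or (item := item) (K := K) (pos := posList π l) (s := s) (τ := pre σ n)
    ((prefix_pre_iff (by omega)).2 hσ) (fun p hp => by
      have := hM (List.mem_toFinset.2 hp)
      omega) with h | ⟨τ', hτ', h⟩
  -- If the prefix is selected, `σ` itself is a selected member that is never won.
  · obtain ⟨fl, x, hx, hax⟩ := hcon σ hself (mem_selectedSet.2 ⟨_, _, h, mem_basicSet_pre σ n⟩)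
    exact hnw fl x hx hax
  · refine h ⟨by have := length_lt_of_mem_selected hτ'; omega, fun ρ hρ hp => ?_⟩
    rw [hlen] at hτ' ⊢
    obtain ⟨a, ha, rfl⟩ := mem_tailMates.1 hρ
    obtain ⟨it, hit, hait⟩ := hJ a ha (mem_selectedSet.2 ⟨_, _, hτ', mem_basicSet_of_prefix_pre hp⟩)
    have hlt : J a < n := by
      have := hN (Set.mem_image_of_mem J ha)
      omega
    have hmem : it ∈ (itemsBelow item n).filter fun it => Covers it.2.1 (pre a n) := by
      simp only [List.mem_filter, itemsBelow, List.mem_filterMap, List.mem_range,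
        decide_eq_true_eq]
      exact ⟨⟨J a, hlt, hit⟩, (covers_pre_iff fun s hs =>
        (hE.size_part _ it hit s hs).trans hlt.le).2 hait⟩
    obtain ⟨it', hit'⟩ : ∃ it', it' ∈ firstCovering (itemsBelow item n) (pre a n) := by
      rw [firstCovering]
      cases hl : (itemsBelow item n).filter fun it => decide (Covers it.2.1 (pre a n)) with
      | nil => rw [hl] at hmem; simp at hmem
      | cons it' _ => exact ⟨it', by simp⟩
    refine ⟨it', hit', ?_⟩
    obtain ⟨j, hj, hji, -⟩ := isFirst_of_mem_firstCovering hE hit'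
    obtain ⟨x, hxw, hx, -⟩ := hE.sound j it' hji
    exact leaves_of_notMem hx (fun q hq => ⟨fun s hs => ((hE.size_path j it' hji q hq).1 s hs).trans
      hj.le, fun s hs => ((hE.size_path j it' hji q hq).2 s hs).trans hj.le⟩) (hnw _ x hxw)
      (hK it'.1)

end Selection

open PartitionRefinement
open scoped ENNReal

/-! ### The measure of the selected set -/

theorem flipAt_injective (σ : BinSeq) : Function.Injective fun m => flipAt m σ := by
  intro m m' h
  ext p
  have := congrFun h p
  simp only [flipAt_apply] at this
  by_cases h₁ : p ∈ m <;> by_cases h₂ : p ∈ m' <;> simp_all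

theorem card_powerset_posSet {π : ℕ → ℕ} (hπ : Function.Injective π) (l : ℕ) :
    (posSet π l).powerset.card = 2 ^ l := by
  rw [Finset.card_powerset, posSet, Finset.card_image_of_injective _ hπ, Finset.card_range]

/-- A set that has at most `N` members in every class of `2 ^ l` sequences has measure at most
`N / 2 ^ l`. -/
theorem two_pow_mul_coinMeasure_le {π : ℕ → ℕ} (hπ : Function.Injective π) {l N : ℕ}
    {U : Set BinSeq} (hU : MeasurableSet U)
    (h : ∀ σ, ∀ T : Finset BinSeq, (∀ a ∈ T, a ∈ (tailRestriction π l σ).cyl) → (∀ a ∈ T, a ∈ U) →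
      T.card ≤ N) : 2 ^ l * coinMeasure U ≤ N := by
  classical
  have hpre : ∀ m, MeasurableSet (flipAt m ⁻¹' U) := fun m =>
    (measurePreserving_flipAt m).measurable hU
  -- Each flip of the free positions carries `U` to a set of equal measure, while pointwise the sum
  -- of indicators counts the members of the class of `σ` in `U`.
  calc 2 ^ l * coinMeasure U
      = ∑ m ∈ (posSet π l).powerset, coinMeasure (flipAt m ⁻¹' U) := by
        rw [Finset.sum_congr rfl fun m _ =>
          (measurePreserving_flipAt m).measure_preimage hU.nullMeasurableSet,
          Finset.sum_const, card_powerset_posSet hπ, nsmul_eq_mul]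
        norm_cast
    _ = ∫⁻ σ, ∑ m ∈ (posSet π l).powerset, (flipAt m ⁻¹' U).indicator 1 σ ∂coinMeasure := by
        rw [lintegral_finsetSum _ fun m _ => measurable_one.indicator (hpre m)]
        exact Finset.sum_congr rfl fun m _ => (lintegral_indicator_one (hpre m)).symm
    _ ≤ ∫⁻ _, N ∂coinMeasure := by
        refine lintegral_mono fun σ => ?_
        have : ∑ m ∈ (posSet π l).powerset, (flipAt m ⁻¹' U).indicator (1 : BinSeq → ℝ≥0∞) σ =
            (((posSet π l).powerset.filter fun m => flipAt m σ ∈ U).card : ℝ≥0∞) := by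
          simp [Set.indicator_apply]
        rw [this, ← Finset.card_image_of_injective _ (flipAt_injective σ)]
        refine Nat.cast_le.2 (h σ _ (fun a ha => ?_) fun a ha => ?_) <;>
        obtain ⟨m, hm, rfl⟩ := Finset.mem_image.1 ha
        · exact mem_tail_cyl_iff_flipAt.2 ⟨m, (Finset.mem_filter.1 hm).1, rfl⟩
        · exact (Finset.mem_filter.1 hm).2
    _ = N := by simp

/-- Countably many flipped copies of the sets `basicSet τ ∩ V` cover `G`; if all were null, so would
be `G`. -/
theorem exists_selected_measure_pos {item : ℕ → Option Item} {s : List Bool} {K : ℕ}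
    {pos : List ℕ} {π : ℕ → ℕ} {l : ℕ} {G V : Set BinSeq} (hG : coinMeasure G ≠ 0)
    (h : ∀ σ ∈ G, ∃ a ∈ (tailRestriction π l σ).cyl, a ∈ selectedSet item s K pos ∧ a ∈ V) :
    ∃ n, ∃ τ ∈ selected item s K pos n, coinMeasure (basicSet τ ∩ V) ≠ 0 := by
  by_contra! hcon
  refine hG (measure_mono_null (t := ⋃ n, ⋃ τ ∈ selected item s K pos n,
    ⋃ m ∈ (posSet π l).powerset, flipAt m ⁻¹' (basicSet τ ∩ V)) (fun σ hσ => ?_) ?_)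
  · obtain ⟨a, ha, has, haV⟩ := h σ hσ
    obtain ⟨n, τ, hτ, haτ⟩ := mem_selectedSet.1 has
    obtain ⟨m, hm, rfl⟩ := mem_tail_cyl_iff_flipAt.1 ha
    simp only [Set.mem_iUnion]
    exact ⟨n, τ, hτ, m, hm, haτ, haV⟩
  · refine measure_iUnion_null fun n => ?_
    refine (measure_biUnion_null_iff (List.finite_toSet _).countable).2 fun τ hτ => ?_
    refine (measure_biUnion_null_iff (Finset.countable_toSet _)).2 fun m _ => ?_
    exact (measurePreserving_flipAt m).quasiMeasurePreserving.preimage_null (hcon n τ hτ)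

theorem measurableSet_selectedSet (item : ℕ → Option Item) (s : List Bool) (K : ℕ)
    (pos : List ℕ) : MeasurableSet (selectedSet item s K pos) :=
  MeasurableSet.iUnion fun _ => MeasurableSet.biUnion (List.finite_toSet _).countable
    fun τ _ => measurableSet_basicSet τ

theorem coinMeasure_selectedSet_le {S : Bool → PartitionRefinement BinSeq}
    {won : Bool → Set (List Bool)} {item : ℕ → Option Item} (hE : Enumerates S won item)
    {π : ℕ → ℕ} (hπ : Function.Injective π) (s : List Bool) (K d : ℕ) :
    coinMeasure (selectedSet item s K (posList π (K + 3 + d))) ≤ 2⁻¹ ^ d := by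
  have h := two_pow_mul_coinMeasure_le hπ (l := K + 3 + d)
    (measurableSet_selectedSet item s K (posList π (K + 3 + d)))
    (card_selectedSet_inter_tail_cyl hE)
  rw [pow_add, mul_assoc, Nat.cast_pow, Nat.cast_ofNat] at h
  have h2 : (2 : ℝ≥0∞) ^ (K + 3) ≠ 0 := by simp
  have h3 : (2 : ℝ≥0∞) ^ (K + 3) ≠ ∞ := by simp
  have h4 : (2 : ℝ≥0∞) ^ d * coinMeasure (selectedSet item s K (posList π (K + 3 + d))) ≤ 1 :=
    (ENNReal.mul_le_mul_iff_right h2 h3).1 (by rwa [mul_one])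
  rw [← ENNReal.inv_pow]
  exact ENNReal.le_inv_iff_mul_le.2 (by rwa [mul_comm])

/-! ### Winning sets -/

namespace BettingStrategy

variable (B : BettingStrategy)

/-- The coordinates at which the capital exceeds `C`. -/
def wonCoords (C : ℝ≥0) : Set (List Bool) := {x | x ∈ B.ref.coords ∧ C < B.capital x}

theorem isClopen_partSet {x : List Bool} (h : x ∈ B.ref.coords) : IsClopen (B.ref.partSet x) :=
  let ⟨t, ht⟩ := exists_mem_part h
  B.clopen t x _ ht

theorem lt_capital_iff {x : List Bool} (h : x ∈ B.ref.coords) {C : ℝ≥0} :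
    C < B.capital x ↔ C * coinMeasure (B.ref.partSet x) < B.mu.mass x := by
  -- A nonempty clopen part contains a cylinder, so the capital is a genuine quotient.
  have hpos : 0 < (coinMeasure (B.ref.partSet x)).toNNReal := by
    refine ENNReal.toNNReal_pos ?_ (measure_ne_top _ _)
    obtain ⟨σ, hσ⟩ := partSet_nonempty h
    obtain ⟨I, u, hu, hsub⟩ := isOpen_pi_iff.1 (B.isClopen_partSet h).isOpen σ hσ
    obtain ⟨N, hN⟩ := I.bddAbove
    have : basicSet (pre σ (N + 1)) ⊆ B.ref.partSet x := fun τ hτ => hsub fun i hi => by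
      have := hτ i (by simpa using Nat.lt_succ_of_le (hN hi))
      rw [this, getElem_pre]
      exact (hu i hi).2
    have hle := measure_mono (μ := coinMeasure) this
    rw [coinMeasure_basicSet] at hle
    exact (lt_of_lt_of_le (ENNReal.pow_pos (by simp) _) hle).ne'
  rw [capital, lt_div_iff₀ hpos, ← ENNReal.coe_lt_coe, ENNReal.coe_mul,
    ENNReal.coe_toNNReal (measure_ne_top _ _)]

/-- The sequences on which the capital exceeds `C` within `n` splits after `x`. -/
def wonWithin (C : ℝ≥0) (x : List Bool) (n : ℕ) : Set BinSeq :=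
  {σ | ∃ y ∈ B.wonCoords C, x <+: y ∧ y.length ≤ x.length + n ∧ σ ∈ B.ref.partSet y}

/-- Kolmogorov's inequality for boundedly many splits: at a won coordinate `C` times the measure is
below the mass, and at any other one the masses of the two children add up. -/
theorem mul_coinMeasure_wonWithin_le (C : ℝ≥0) (x : List Bool) (n : ℕ) :
    C * coinMeasure (B.wonWithin C x n) ≤ B.mu.mass x := by
  by_cases hx : x ∈ B.wonCoords C
  · refine le_trans ?_ ((B.lt_capital_iff hx.1).1 hx.2).le
    gcongr
    rintro σ ⟨y, -, hxy, -, hσ⟩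
    exact partSet_subset_of_prefix hxy hσ
  induction n generalizing x with
  | zero =>
    have : B.wonWithin C x 0 = ∅ := by
      refine Set.eq_empty_of_forall_notMem ?_
      rintro σ ⟨y, hy, hxy, hl, -⟩
      exact hx (hxy.eq_of_length_le (by simpa using hl) ▸ hy)
    simp [this]
  | succ n ih =>
    have ih' : ∀ x, C * coinMeasure (B.wonWithin C x n) ≤ B.mu.mass x := by
      intro x
      by_cases hx : x ∈ B.wonCoords C
      · refine le_trans ?_ ((B.lt_capital_iff hx.1).1 hx.2).le
        gcongr
        rintro σ ⟨y, -, hxy, -, hσ⟩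
        exact partSet_subset_of_prefix hxy hσ
      · exact ih x hx
    have hsub : B.wonWithin C x (n + 1) ⊆
        B.wonWithin C (x ++ [false]) n ∪ B.wonWithin C (x ++ [true]) n := by
      rintro σ ⟨y, hy, hxy, hl, hσ⟩
      obtain ⟨b, hb⟩ := exists_append_singleton_prefix hxy (by rintro rfl; exact hx hy)
      have hl' : y.length ≤ (x ++ [b]).length + n := by
        simp only [List.length_append, List.length_singleton]; omega
      cases b
      · exact Or.inl ⟨y, hy, hb, hl', hσ⟩
      · exact Or.inr ⟨y, hy, hb, hl', hσ⟩
    calc C * coinMeasure (B.wonWithin C x (n + 1))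
        ≤ C * (coinMeasure (B.wonWithin C (x ++ [false]) n) +
            coinMeasure (B.wonWithin C (x ++ [true]) n)) := by
          gcongr
          exact (measure_mono hsub).trans (measure_union_le _ _)
      _ ≤ B.mu.mass (x ++ [false]) + B.mu.mass (x ++ [true]) := by
          rw [mul_add]; exact add_le_add (ih' _) (ih' _)
      _ = B.mu.mass x := by rw [B.mu.mass_split x, ENNReal.coe_add]

/-- The sequences on which the capital never exceeds `C`. -/
def unwonSet (C : ℝ≥0) : Set BinSeq := {σ | ∀ x ∈ B.wonCoords C, σ ∉ B.ref.partSet x}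

theorem mul_coinMeasure_compl_unwonSet_le (C : ℝ≥0) :
    C * coinMeasure (B.unwonSet C)ᶜ ≤ B.mu.mass [] := by
  have h : (B.unwonSet C)ᶜ = ⋃ n, B.wonWithin C [] n := by
    ext σ
    simp only [unwonSet, Set.mem_compl_iff, Set.mem_ofPred_eq, not_forall, not_not, Set.mem_iUnion,
      wonWithin, List.nil_prefix, true_and, List.length_nil, zero_add]
    constructor
    · rintro ⟨x, hx, hσ⟩
      exact ⟨x.length, x, hx, le_rfl, hσ⟩
    · rintro ⟨-, x, hx, -, hσ⟩
      exact ⟨x, hx, hσ⟩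
  have hmono : Monotone fun n => B.wonWithin C [] n := by
    rintro m n hmn σ ⟨y, hy, hxy, hl, hσ⟩
    exact ⟨y, hy, hxy, by omega, hσ⟩
  rw [h, hmono.measure_iUnion, ENNReal.mul_iSup]
  exact iSup_le fun n => B.mul_coinMeasure_wonWithin_le C [] n

theorem isClosed_unwonSet (C : ℝ≥0) : IsClosed (B.unwonSet C) := by
  have : B.unwonSet C = ⋂ x ∈ B.wonCoords C, (B.ref.partSet x)ᶜ := by
    ext σ; simp [unwonSet]
  rw [this]
  exact isClosed_biInter fun x hx => (B.isClopen_partSet hx.1).isOpen.isClosed_compl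

theorem not_wins_of_mem_unwonSet {C : ℝ≥0} {σ : BinSeq} (h : σ ∈ B.unwonSet C) :
    ¬ B.Wins σ := by
  intro hw
  obtain ⟨t, c, ⟨x, -, ⟨v, hv, hσ⟩, rfl⟩, hc⟩ := hw C
  refine hc.not_ge (Finset.sup_le fun y hy => ?_)
  have hyx : y <+: x := by simpa using hy
  have hσy : σ ∈ B.ref.partSet y := partSet_subset_of_prefix hyx (B.ref.partSet_eq hv ▸ hσ)
  by_contra hlt
  exact h y ⟨mem_coords_of_mem_partSet hσy, not_le.1 hlt⟩ hσy

end BettingStrategy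

/-- If the intersection were null, the two complements would cover almost everything, forcing `C` to
be at most the sum of the initial masses. -/
theorem exists_coinMeasure_inter_unwonSet_ne_zero (A B : BettingStrategy) :
    ∃ C : ℕ, coinMeasure (A.unwonSet C ∩ B.unwonSet C) ≠ 0 := by
  obtain ⟨C, hC⟩ := exists_nat_gt (A.mu.mass [] + B.mu.mass [])
  refine ⟨C, fun h0 => ?_⟩
  have h1 : coinMeasure ((A.unwonSet C)ᶜ ∪ (B.unwonSet C)ᶜ) = 1 := by
    rw [← Set.compl_inter]
    exact (prob_compl_eq_one_iff ((A.isClosed_unwonSet C).inter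
      (B.isClosed_unwonSet C)).measurableSet).2 h0
  have h2 : ((C : ℝ≥0) : ℝ≥0∞) * 1 ≤ A.mu.mass [] + B.mu.mass [] := by
    rw [← h1]
    calc ((C : ℝ≥0) : ℝ≥0∞) * coinMeasure ((A.unwonSet C)ᶜ ∪ (B.unwonSet C)ᶜ)
        ≤ (C : ℝ≥0) * (coinMeasure (A.unwonSet C)ᶜ + coinMeasure (B.unwonSet C)ᶜ) := by
          gcongr; exact measure_union_le _ _
      _ ≤ _ := by
          rw [mul_add]
          exact add_le_add (A.mul_coinMeasure_compl_unwonSet_le C)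
            (B.mul_coinMeasure_compl_unwonSet_le C)
  rw [mul_one, ← ENNReal.coe_add, ENNReal.coe_le_coe] at h2
  exact absurd h2 hC.not_ge

/-! ### Non-random elements of a closed set -/

/-- If a closed set of positive measure can be met, with positive measure and inside any given
cylinder, by uniformly enumerable sets of arbitrarily small measure, then it has a non-random
element. -/
theorem exists_not_isMLRandom {h : ℕ × ℕ → List Bool} (hh : Computable h)
    (hmeas : ∀ e, coinMeasure (⋃ i, basicSet (h (e, i))) ≤ 2⁻¹ ^ e)
    {V : Set BinSeq} (hV : IsClosed V) (hV0 : coinMeasure V ≠ 0)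
    (step : ∀ s, coinMeasure (basicSet s ∩ V) ≠ 0 → ∀ N, ∃ e ≥ N, ∃ i, s <+: h (e, i) ∧
      coinMeasure (basicSet (h (e, i)) ∩ V) ≠ 0) :
    ∃ σ ∈ V, ¬ IsMLRandom σ := by
  choose! E hE I hI hI' using step
  -- The choices `E` and `I` need not be effective: only the sets enumerated by `h` enter the test.
  let seq : ℕ → List Bool := fun n => n.rec [] fun N s => h (E s N, I s N)
  have hseq : ∀ N, seq (N + 1) = h (E (seq N) N, I (seq N) N) := fun N => rfl
  have hpos : ∀ N, coinMeasure (basicSet (seq N) ∩ V) ≠ 0 := by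
    intro N
    induction N with
    | zero =>
      change coinMeasure (basicSet [] ∩ V) ≠ 0
      rwa [basicSet_nil, Set.univ_inter]
    | succ N ih => rw [hseq]; exact hI' _ ih N
  obtain ⟨σ, hσ⟩ := IsCompact.nonempty_iInter_of_sequence_nonempty_isCompact_isClosed
    (fun N => basicSet (seq N) ∩ V)
    (fun N => Set.inter_subset_inter_left _ (basicSet_subset_of_prefix (by
      rw [hseq]; exact hI _ (hpos N) N)))
    (fun N => nonempty_of_measure_ne_zero (hpos N))
    ((isClopen_basicSet _).isClosed.inter hV).isCompact
    (fun N => (isClopen_basicSet _).isClosed.inter hV)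
  rw [Set.mem_iInter] at hσ
  refine ⟨σ, (hσ 0).2, fun hr => ?_⟩
  -- Level `n` is the union over all indices `e ≥ n + 2`; the shift makes the geometric series sum
  -- to `2⁻¹ ^ (n + 1)`, strictly below the required bound.
  have hlevel : ∀ n, level (fun p => h (p.1 + 2 + p.2.unpair.1, p.2.unpair.2)) n =
      ⋃ a, ⋃ i, basicSet (h (n + 2 + a, i)) := by
    intro n
    ext τ
    simp only [level, Set.mem_iUnion]
    constructor
    · rintro ⟨k, hk⟩
      exact ⟨_, _, hk⟩
    · rintro ⟨a, i, hk⟩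
      exact ⟨Nat.pair a i, by simpa using hk⟩
  have htest : IsMLTest fun p => h (p.1 + 2 + p.2.unpair.1, p.2.unpair.2) := by
    refine ⟨?_, ?_, ?_⟩
    · have h1 : Computable fun p : ℕ × ℕ => p.2.unpair := Computable.unpair.comp Computable.snd
      refine hh.comp (Computable.pair ?_ (Computable.snd.comp h1))
      exact Primrec.nat_add.to_comp.comp (Primrec.nat_add.to_comp.comp Computable.fst
        (Computable.const 2)) (Computable.fst.comp h1)
    · intro n
      rw [hlevel]
      calc coinMeasure (⋃ a, ⋃ i, basicSet (h (n + 2 + a, i)))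
          ≤ ∑' a, (2⁻¹ : ℝ≥0∞) ^ (n + 2 + a) :=
            (measure_iUnion_le _).trans (ENNReal.tsum_le_tsum fun a => hmeas _)
        _ = 2⁻¹ ^ (n + 1) := by
            simp_rw [pow_add _ (n + 2), ENNReal.tsum_mul_left]
            rw [ENNReal.tsum_geometric, ENNReal.one_sub_inv_two, inv_inv, pow_succ, mul_assoc,
              ENNReal.inv_mul_cancel (by simp) (by simp), mul_one]
        _ < 2⁻¹ ^ n := by
            rw [pow_succ, ← div_eq_mul_inv]
            exact ENNReal.half_lt_self (by simp) (by simp)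
    · intro n τ hτ
      rw [hlevel] at hτ ⊢
      simp only [Set.mem_iUnion] at hτ ⊢
      obtain ⟨a, i, h1⟩ := hτ
      exact ⟨1 + a, i, by rwa [show n + 2 + (1 + a) = n + 1 + 2 + a by omega]⟩
  obtain ⟨n, hn⟩ := hr _ htest
  rw [hlevel] at hn
  refine hn ?_
  have h1 := (hσ (n + 2 + 1)).1
  rw [hseq (n + 2)] at h1
  have h2 := hE _ (hpos (n + 2)) (n + 2)
  simp only [Set.mem_iUnion]
  refine ⟨E (seq (n + 2)) (n + 2) - (n + 2), I (seq (n + 2)) (n + 2), ?_⟩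
  rwa [Nat.add_sub_cancel' h2]

/-! ### Computability of the selection -/

/-! ### Primitive recursiveness of bounded quantifiers and filters -/

section Quantifiers

variable {α β : Type*} [Primcodable α] [Primcodable β]

theorem primrecPred_exists_mem {L : α → List β} (hL : Primrec L) {R : α → β → Prop}
    (hR : PrimrecPred fun p : α × β => R p.1 p.2) : PrimrecPred fun a => ∃ b ∈ L a, R a b :=
  PrimrecRel.comp (PrimrecRel.exists_mem_list (R := fun b a => R a b)
    (hR.comp (Primrec.pair .snd .fst)).primrecRel) hL .id

theorem primrecPred_forall_mem {L : α → List β} (hL : Primrec L) {R : α → β → Prop}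
    (hR : PrimrecPred fun p : α × β => R p.1 p.2) : PrimrecPred fun a => ∀ b ∈ L a, R a b :=
  PrimrecRel.comp (PrimrecRel.forall_mem_list (R := fun b a => R a b)
    (hR.comp (Primrec.pair .snd .fst)).primrecRel) hL .id

theorem primrecPred_exists_lt {n : α → ℕ} (hn : Primrec n) {R : α → ℕ → Prop}
    (hR : PrimrecPred fun p : α × ℕ => R p.1 p.2) : PrimrecPred fun a => ∃ i < n a, R a i :=
  (primrecPred_exists_mem (Primrec.list_range.comp hn) hR).of_eq fun a => by simp

theorem primrecPred_forall_lt {n : α → ℕ} (hn : Primrec n) {R : α → ℕ → Prop}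
    (hR : PrimrecPred fun p : α × ℕ => R p.1 p.2) : PrimrecPred fun a => ∀ i < n a, R a i :=
  (primrecPred_forall_mem (Primrec.list_range.comp hn) hR).of_eq fun a => by simp

theorem primrec_filter {L : α → List β} (hL : Primrec L) {R : α → β → Prop}
    [∀ a b, Decidable (R a b)] (hR : PrimrecPred fun p : α × β => R p.1 p.2) :
    Primrec fun a => (L a).filter fun b => R a b :=
  have h := PrimrecRel.listFilter (R := fun b a => R a b)
    (hR.comp (Primrec.pair .snd .fst)).primrecRel
  Primrec.comp (f := fun p : List β × α => p.1.filter fun b => R p.2 b) h (Primrec.pair hL .id)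

end Quantifiers

/-! ### Effectiveness of the tests and of the selection -/

section Selection

variable {α : Type*} [Primcodable α]

theorem primrecPred_prefix {f g : α → List Bool} (hf : Primrec f) (hg : Primrec g) :
    PrimrecPred fun a => f a <+: g a :=
  (Primrec.eq.comp hf (Primrec.list_take.comp (Primrec.list_length.comp hf) hg)).of_eq
    fun _ => List.prefix_iff_eq_take.symm

theorem primrecPred_covers {f : α → List (List Bool)} {g : α → List Bool} (hf : Primrec f)
    (hg : Primrec g) : PrimrecPred fun a => Covers (f a) (g a) :=
  primrecPred_exists_mem hf (primrecPred_prefix .snd (hg.comp .fst))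

theorem primrec_allStrings : Primrec allStrings := by
  have hstep : Primrec₂ fun (_ : ℕ) (L : List (List Bool)) =>
      L.flatMap fun s => [s ++ [false], s ++ [true]] := by
    refine Primrec.list_flatMap .snd ?_
    have happ : ∀ b : Bool, Primrec fun p : (ℕ × List (List Bool)) × List Bool => p.2 ++ [b] :=
      fun b => Primrec.list_append.comp .snd (.const _)
    exact Primrec.list_cons.comp (happ false) (Primrec.list_cons.comp (happ true) (.const []))
  refine (Primrec.nat_rec₁ [[]] hstep).of_eq fun n => ?_
  induction n with
  | zero => rfl
  | succ n ih => rw [allStrings, ← ih]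

theorem primrec_tailMates {pos : α → List ℕ} {τ : α → List Bool} (hpos : Primrec pos)
    (hτ : Primrec τ) : Primrec fun a => tailMates (pos a) (τ a) := by
  refine primrec_filter (R := fun a ρ => ∀ i < (τ a).length, i ∈ pos a ∨ ρ[i]? = (τ a)[i]?)
    (primrec_allStrings.comp (Primrec.list_length.comp hτ)) ?_
  refine primrecPred_forall_lt (Primrec.list_length.comp (hτ.comp .fst)) (PrimrecPred.or ?_ ?_)
  · exact (primrecPred_exists_mem (L := fun p : (α × List Bool) × ℕ => pos p.1.1)
      (R := fun p j => j = p.2) (hpos.comp (Primrec.fst.comp .fst))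
      (Primrec.eq.comp .snd (Primrec.snd.comp .fst))).of_eq fun p => by simp
  · exact Primrec.eq.comp (Primrec.list_getElem?.comp (Primrec.snd.comp .fst) .snd)
      (Primrec.list_getElem?.comp (hτ.comp (Primrec.fst.comp .fst)) .snd)

theorem primrecPred_meets {pos : α → List ℕ} {τ : α → List Bool} {c : α → List (List Bool)}
    (hpos : Primrec pos) (hτ : Primrec τ) (hc : Primrec c) :
    PrimrecPred fun a => Meets (pos a) (τ a) (c a) :=
  primrecPred_exists_mem (primrec_tailMates hpos hτ) (primrecPred_covers (hc.comp .fst) .snd)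

theorem primrec_pathSplits {pos : α → List ℕ} {τ : α → List Bool} {P : α → PathData}
    (hpos : Primrec pos) (hτ : Primrec τ) (hP : Primrec P) :
    Primrec fun a => pathSplits (pos a) (τ a) (P a) :=
  Primrec.list_length.comp (primrec_filter hP (PrimrecPred.and
    (primrecPred_meets (hpos.comp .fst) (hτ.comp .fst) (Primrec.fst.comp .snd))
    (primrecPred_meets (hpos.comp .fst) (hτ.comp .fst) (Primrec.snd.comp .snd))))

theorem primrecPred_leaves {K : α → ℕ} {pos : α → List ℕ} {τ : α → List Bool} {P : α → PathData}
    (hK : Primrec K) (hpos : Primrec pos) (hτ : Primrec τ) (hP : Primrec P) :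
    PrimrecPred fun a => Leaves (K a) (pos a) (τ a) (P a) := by
  refine primrecPred_exists_lt (Primrec.list_length.comp hP) (PrimrecPred.and ?_ ?_)
  · refine primrecPred_exists_mem (Primrec.list_take.comp (.const 1)
      (Primrec.list_drop.comp .snd (hP.comp .fst))) ?_
    exact primrecPred_covers (Primrec.snd.comp .snd) (hτ.comp (Primrec.fst.comp .fst))
  · exact Primrec.nat_le.comp (primrec_pathSplits (hpos.comp .fst) (hτ.comp .fst)
      (Primrec.list_drop.comp (Primrec.succ.comp .snd) (hP.comp .fst))) (hK.comp .fst)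

theorem primrec_firstCovering {items : α → List Item} {ρ : α → List Bool} (hitems : Primrec items)
    (hρ : Primrec ρ) : Primrec fun a => firstCovering (items a) (ρ a) :=
  Primrec.list_take.comp (.const 1) (primrec_filter hitems
    (primrecPred_covers (Primrec.fst.comp (Primrec.snd.comp .snd)) (hρ.comp .fst)))

theorem primrecPred_compatible {K : α → ℕ} {pos : α → List ℕ} {items : α → List Item}
    {τ τ' : α → List Bool} (hK : Primrec K) (hpos : Primrec pos) (hitems : Primrec items)
    (hτ : Primrec τ) (hτ' : Primrec τ') :
    PrimrecPred fun a => Compatible (K a) (pos a) (items a) (τ a) (τ' a) := by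
  refine (Primrec.nat_le.comp (Primrec.list_length.comp hτ') (Primrec.list_length.comp hτ)).and ?_
  refine primrecPred_forall_mem (R := fun a ρ => τ' a <+: ρ →
    ∃ it ∈ firstCovering (items a) ρ, Leaves (K a) (pos a) (τ a) it.2.2)
    (primrec_tailMates hpos hτ) ?_
  refine ((primrecPred_prefix (hτ'.comp .fst) .snd).not.or (primrecPred_exists_mem
    (R := fun p it => Leaves (K p.1) (pos p.1) (τ p.1) it.2.2)
    (primrec_firstCovering (hitems.comp .fst) .snd) (primrecPred_leaves
      (hK.comp (Primrec.fst.comp .fst)) (hpos.comp (Primrec.fst.comp .fst))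
      (hτ.comp (Primrec.fst.comp .fst))
      (Primrec.snd.comp (Primrec.snd.comp .snd))))).of_eq fun a => ?_
  exact imp_iff_not_or.symm

theorem primrecPred_selectable {s : α → List Bool} {K : α → ℕ} {pos : α → List ℕ}
    {items : α → List Item} {prev : α → List (List Bool)} {τ : α → List Bool} (hs : Primrec s)
    (hK : Primrec K) (hpos : Primrec pos) (hitems : Primrec items) (hprev : Primrec prev)
    (hτ : Primrec τ) :
    PrimrecPred fun a => Selectable (s a) (K a) (pos a) (items a) (prev a) (τ a) := by
  refine (primrecPred_prefix hs hτ).and (PrimrecPred.and ?_ ?_)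
  · exact primrecPred_forall_mem hpos
      (Primrec.nat_lt.comp .snd (Primrec.list_length.comp (hτ.comp .fst)))
  · exact primrecPred_forall_mem hprev (primrecPred_compatible (hK.comp .fst) (hpos.comp .fst)
      (hitems.comp .fst) (hτ.comp .fst) .snd)

theorem primrec_selectLevel {s : α → List Bool} {K : α → ℕ} {pos : α → List ℕ}
    {items : α → List Item} {n : α → ℕ} {prev : α → List (List Bool)} (hs : Primrec s)
    (hK : Primrec K) (hpos : Primrec pos) (hitems : Primrec items) (hn : Primrec n)
    (hprev : Primrec prev) :
    Primrec fun a => selectLevel (s a) (K a) (pos a) (items a) (n a) (prev a) := by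
  refine Primrec.list_foldl (primrec_allStrings.comp hn) hprev (h := fun a p =>
    if Selectable (s a) (K a) (pos a) (items a) p.1 p.2 then p.2 :: p.1 else p.1) ?_
  have h₁ : Primrec fun q : α × List (List Bool) × List Bool => q.2.1 := Primrec.fst.comp .snd
  have h₂ : Primrec fun q : α × List (List Bool) × List Bool => q.2.2 := Primrec.snd.comp .snd
  exact Primrec.ite (primrecPred_selectable (hs.comp .fst) (hK.comp .fst) (hpos.comp .fst)
    (hitems.comp .fst) h₁ h₂) (Primrec.list_cons.comp h₂ h₁) h₁

theorem computable_itemsBelow {item : ℕ → Option Item} (h : Computable item) :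
    Computable (itemsBelow item) := by
  have hstep : Computable₂ fun (_ : ℕ) (p : ℕ × List Item) => p.2 ++ (item p.1).toList :=
    Computable.list_append.comp (Computable.snd.comp .snd)
      (Primrec.optionToList.to_comp.comp (h.comp (Computable.fst.comp .snd)))
  refine (Computable.nat_rec Computable.id (Computable.const []) hstep).of_eq fun n => ?_
  simp only [id]
  induction n with
  | zero => rfl
  | succ n ih =>
    rw [itemsBelow, List.range_succ, List.filterMap_append, ← itemsBelow, ← ih]
    cases hi : item n <;> simp [hi]

theorem computable_posList {π : ℕ → ℕ} (h : Computable π) : Computable (posList π) := by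
  have hstep : Computable₂ fun (_ : ℕ) (p : ℕ × List ℕ) => p.2 ++ [π p.1] :=
    Computable.list_concat.comp (Computable.snd.comp .snd) (h.comp (Computable.fst.comp .snd))
  refine (Computable.nat_rec Computable.id (Computable.const []) hstep).of_eq fun n => ?_
  simp only [id]
  induction n with
  | zero => rfl
  | succ n ih => rw [posList, List.range_succ, List.map_append, ← posList, ← ih]; rfl

theorem computable_selected {item : ℕ → Option Item} (hitem : Computable item)
    {s : ℕ → List Bool} {K : ℕ → ℕ} {pos : ℕ → List ℕ} (hs : Computable s) (hK : Computable K)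
    (hpos : Computable pos) :
    Computable fun p : ℕ × ℕ => selected item (s p.1) (K p.1) (pos p.1) p.2 := by
  have hlev : Primrec fun q : (List Bool × ℕ × List ℕ) × List Item × ℕ × List (List Bool) =>
      selectLevel q.1.1 q.1.2.1 q.1.2.2 q.2.1 q.2.2.1 q.2.2.2 :=
    primrec_selectLevel (Primrec.fst.comp .fst) (Primrec.fst.comp (Primrec.snd.comp .fst))
      (Primrec.snd.comp (Primrec.snd.comp .fst)) (Primrec.fst.comp .snd)
      (Primrec.fst.comp (Primrec.snd.comp .snd)) (Primrec.snd.comp (Primrec.snd.comp .snd))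
  have hstep : Computable₂ fun (p : ℕ × ℕ) (r : ℕ × List (List Bool)) =>
      selectLevel (s p.1) (K p.1) (pos p.1) (itemsBelow item r.1) r.1 r.2 := by
    have h₁ : Computable fun q : (ℕ × ℕ) × ℕ × List (List Bool) => q.1.1 :=
      Computable.fst.comp .fst
    have h₂ : Computable fun q : (ℕ × ℕ) × ℕ × List (List Bool) => q.2.1 :=
      Computable.fst.comp .snd
    exact hlev.to_comp.comp (Computable.pair
      (Computable.pair (hs.comp h₁) (Computable.pair (hK.comp h₁) (hpos.comp h₁)))
      (Computable.pair ((computable_itemsBelow hitem).comp h₂)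
        (Computable.pair h₂ (Computable.snd.comp .snd))))
  refine (Computable.nat_rec Computable.snd (Computable.const []) hstep).of_eq fun p => ?_
  induction p.2 with
  | zero => rfl
  | succ n ih => rw [selected, ← ih]

end Selection

open PartitionRefinement
open scoped ENNReal

/-! ### Enumerating the won coordinates -/

/-- Dovetailing over inputs and running times. Values recur at arbitrarily late stages, so one that
comes too early may be discarded without loss. -/
theorem exists_computable_enumeration {α β : Type*} [Primcodable α] [Primcodable β] {F : α →. β}
    (hF : Partrec F) : ∃ E : ℕ → Option β, Computable E ∧
      (∀ k b, E k = some b → ∃ a, b ∈ F a) ∧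
      ∀ a, ∀ b ∈ F a, ∀ N, ∃ k ≥ N, E k = some b := by
  obtain ⟨c, hc⟩ := Nat.Partrec.Code.exists_code.1 hF
  refine ⟨fun k => (Nat.Partrec.Code.evaln k.unpair.2 c k.unpair.1).bind
    (Encodable.decode (α := β)), ?_, ?_, ?_⟩
  · refine Computable.option_bind (Nat.Partrec.Code.primrec_evaln.to_comp.comp
      (Computable.pair (Computable.pair (Computable.snd.comp Computable.unpair)
        (Computable.const c)) (Computable.fst.comp Computable.unpair))) ?_
    exact Computable.decode.comp .snd
  · intro k b hb
    obtain ⟨m, hm, hmb⟩ := Option.bind_eq_some_iff.1 hb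
    have := Nat.Partrec.Code.evaln_sound hm
    rw [hc] at this
    obtain ⟨a, -, ha⟩ := Part.mem_bind_iff.1 this
    obtain ⟨b', hb', rfl⟩ := (Part.mem_map_iff _).1 ha
    rw [Encodable.encodek] at hmb
    exact ⟨a, Option.some_injective _ hmb ▸ hb'⟩
  · intro a b hb N
    have : Encodable.encode b ∈ c.eval (Encodable.encode a) := by
      rw [hc]
      exact Part.mem_bind (by simp [Encodable.encodek]) (Part.mem_map _ hb)
    obtain ⟨k, hk⟩ := Nat.Partrec.Code.evaln_complete.1 this
    refine ⟨Nat.pair (Encodable.encode a) (max k N),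
      (le_max_right k N).trans (Nat.right_le_pair _ _), ?_⟩
    have hk' := Nat.Partrec.Code.evaln_mono (le_max_left k N) hk
    simp only [Nat.unpair_pair]
    rw [Option.mem_def.1 hk']
    simp

/-- The encoding sends `n ≥ 0` to `2 * n` and negative integers to odd codes. -/
theorem primrec_int_toNat : Primrec Int.toNat := by
  have h : Primrec fun z : ℤ => if (Encodable.encode z).bodd then 0 else (Encodable.encode z).div2 :=
    (Primrec.cond (Primrec.nat_bodd.comp .encode) (.const 0)
      (Primrec.nat_div2.comp .encode)).of_eq fun z => by
        cases (Encodable.encode z).bodd <;> rfl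
  refine h.of_eq fun z => ?_
  cases z with
  | ofNat n =>
    change (if (2 * n).bodd then 0 else (2 * n).div2) = n
    simp [Nat.div2_val]
  | negSucc n =>
    change (if (2 * n + 1).bodd then 0 else (2 * n + 1).div2) = 0
    simp

theorem primrec_compatCount : Primrec₂ compatCount := by
  refine Primrec.list_length.comp (primrec_filter
    (R := fun p τ => ∃ s ∈ p.2, s <+: τ ∨ τ <+: s) (primrec_allStrings.comp .fst) ?_)
  exact primrecPred_exists_mem (R := fun p s => s <+: p.2 ∨ p.2 <+: s)
    (Primrec.snd.comp .fst) (PrimrecPred.or (primrecPred_prefix .snd (Primrec.snd.comp .fst))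
      (primrecPred_prefix (Primrec.snd.comp .fst) .snd))

/-- The description of the path to `x.take i`, read at time `t`. -/
def pathUpTo (code : ℕ × List Bool →. List (List Bool)) (t : ℕ) (x : List Bool) :
    ℕ → Part PathData
  | 0 => Part.some []
  | i + 1 => (pathUpTo code t x i).bind fun P => (code (t, x.take (i + 1))).bind fun c =>
      (code (t, x.take i ++ [!x.getD i false])).map fun d => (c, d) :: P

theorem partrec_pathUpTo {code : ℕ × List Bool →. List (List Bool)} (h : Partrec code) :
    Partrec fun p : ℕ × List Bool => pathUpTo code p.1 p.2 p.2.length := by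
  have hstep : Partrec₂ fun (p : ℕ × List Bool) (q : ℕ × PathData) =>
      (code (p.1, p.2.take (q.1 + 1))).bind fun c =>
        (code (p.1, p.2.take q.1 ++ [!p.2.getD q.1 false])).map fun d => (c, d) :: q.2 := by
    have e₁ : Primrec fun r : (ℕ × List Bool) × ℕ × PathData =>
        (r.1.1, r.1.2.take (r.2.1 + 1)) :=
      Primrec.pair (Primrec.fst.comp .fst) (Primrec.list_take.comp
        (Primrec.succ.comp (Primrec.fst.comp .snd)) (Primrec.snd.comp .fst))
    have e₂ : Primrec fun r : (ℕ × List Bool) × ℕ × PathData =>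
        (r.1.1, r.1.2.take r.2.1 ++ [!r.1.2.getD r.2.1 false]) :=
      Primrec.pair (Primrec.fst.comp .fst) (Primrec.list_concat.comp
        (Primrec.list_take.comp (Primrec.fst.comp .snd) (Primrec.snd.comp .fst))
        (Primrec.not.comp ((Primrec.list_getD false).comp (Primrec.snd.comp .fst)
          (Primrec.fst.comp .snd))))
    refine Partrec.bind (h.comp e₁.to_comp) (Partrec.map (h.comp (e₂.to_comp.comp .fst)) ?_)
    exact (Primrec.list_cons.comp (Primrec.pair (Primrec.snd.comp .fst) .snd)
      (Primrec.snd.comp (Primrec.snd.comp (Primrec.fst.comp .fst)))).to_comp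
  refine (Partrec.nat_rec (Computable.list_length.comp .snd)
    (Computable.const ([] : PathData)).partrec hstep).of_eq fun p => ?_
  induction p.2.length with
  | zero => rfl
  | succ n ih => rw [pathUpTo, ← ih]

section Path

variable {S : PartitionRefinement BinSeq} {code : ℕ × List Bool →. List (List Bool)}

theorem unionSet_eq_partSet (hcode : ∀ t x, S.part t x = (code (t, x)).map unionSet) {t : ℕ}
    {x : List Bool} {c : List (List Bool)} (hc : c ∈ code (t, x)) :
    x ∈ S.coords ∧ unionSet c = S.partSet x := by
  have h : unionSet c ∈ S.part t x := hcode t x ▸ Part.mem_map _ hc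
  exact ⟨⟨t, h.1⟩, (S.partSet_eq h).symm⟩

theorem isPath_of_mem_pathUpTo (hcode : ∀ t x, S.part t x = (code (t, x)).map unionSet) {t : ℕ}
    {x : List Bool} {i : ℕ} (hi : i ≤ x.length) {P : PathData} (hP : P ∈ pathUpTo code t x i) :
    IsPath S (x.take i) P := by
  induction i generalizing P with
  | zero =>
    rw [pathUpTo, Part.mem_some_iff] at hP
    rw [hP, List.take_zero]
    exact IsPath.nil
  | succ i ih =>
    obtain ⟨Q, hQ, h⟩ := Part.mem_bind_iff.1 hP
    obtain ⟨c, hc, h⟩ := Part.mem_bind_iff.1 h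
    obtain ⟨d, hd, rfl⟩ := (Part.mem_map_iff _).1 h
    have htake : x.take (i + 1) = x.take i ++ [x.getD i false] := by
      rw [List.take_succ_eq_append_getElem (by omega), List.getD_eq_getElem _ _ (by omega)]
    rw [htake] at hc ⊢
    obtain ⟨hx, hcx⟩ := unionSet_eq_partSet hcode hc
    exact IsPath.snoc (ih (by omega) hQ) hx hcx (unionSet_eq_partSet hcode hd).2

theorem exists_mem_pathUpTo (hcode : ∀ t x, S.part t x = (code (t, x)).map unionSet) {t : ℕ}
    {x : List Bool} {i : ℕ} (hi : i ≤ x.length) (hx : (S.part t x).Dom) :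
    ∃ P, P ∈ pathUpTo code t x i := by
  have hdom : ∀ y, (S.part t y).Dom → ∃ c, c ∈ code (t, y) := fun y hy => by
    rw [hcode] at hy
    exact ⟨(code (t, y)).get hy, Part.get_mem _⟩
  induction i with
  | zero => exact ⟨[], Part.mem_some _⟩
  | succ i ih =>
    obtain ⟨P, hP⟩ := ih (by omega)
    have htake : x.take (i + 1) = x.take i ++ [x.getD i false] := by
      rw [List.take_succ_eq_append_getElem (by omega), List.getD_eq_getElem _ _ (by omega)]
    have h₁ : (S.part t (x.take (i + 1))).Dom := dom_of_prefix (List.take_prefix _ _) hx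
    obtain ⟨c, hc⟩ := hdom _ h₁
    obtain ⟨d, hd⟩ := hdom _ ((child_dom' (htake ▸ h₁)).2 (!x.getD i false))
    exact ⟨(c, d) :: P, Part.mem_bind hP (Part.mem_bind hc (Part.mem_map _ hd))⟩

end Path

/-- The item of the coordinate `x` read at time `t`, provided that the approximation of its mass
with precision `2 ^ (-n)` shows that its capital exceeds `C`. -/
def itemAt (fl : Bool) (code : ℕ × List Bool →. List (List Bool)) (a : List Bool × ℕ →. ℤ) (C : ℕ)
    (p : (ℕ × List Bool) × ℕ) : Part (Option Item) :=
  (pathUpTo code p.1.1 p.1.2 p.1.2.length).bind fun P => (code p.1).bind fun c =>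
    (a (p.1.2, p.2)).map fun z =>
      if C * compatCount p.2 c + 1 < z.toNat then some (fl, c, P) else none

theorem partrec_itemAt (fl : Bool) {code : ℕ × List Bool →. List (List Bool)} (hcode : Partrec code)
    {a : List Bool × ℕ →. ℤ} (ha : Partrec a) (C : ℕ) : Partrec (itemAt fl code a C) := by
  refine Partrec.bind ((partrec_pathUpTo hcode).comp .fst) (Partrec.bind
    (hcode.comp (Computable.fst.comp .fst)) (Partrec.map (ha.comp ?_) ?_))
  · exact Computable.pair (Computable.snd.comp (Computable.fst.comp (Computable.fst.comp .fst)))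
      (Computable.snd.comp (Computable.fst.comp .fst))
  · have hc : Primrec fun r : ((((ℕ × List Bool) × ℕ) × PathData) × List (List Bool)) × ℤ =>
        r.1.2 := Primrec.snd.comp .fst
    refine (Primrec.ite (Primrec.nat_lt.comp (Primrec.succ.comp (Primrec.nat_mul.comp (.const C)
      (primrec_compatCount.comp (Primrec.snd.comp (Primrec.fst.comp (Primrec.fst.comp .fst))) hc)))
      (primrec_int_toNat.comp .snd)) (Primrec.option_some.comp (Primrec.pair (.const fl)
      (Primrec.pair hc (Primrec.snd.comp (Primrec.fst.comp .fst))))) (.const none)).to_comp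

/-- All strings in the item have length at most `n`. -/
def Item.SizeLE (it : Item) (n : ℕ) : Prop := (∀ s ∈ it.2.1, s.length ≤ n) ∧ it.2.2.SizeLE n

instance (it : Item) (n : ℕ) : Decidable (it.SizeLE n) :=
  inferInstanceAs (Decidable ((∀ s ∈ it.2.1, s.length ≤ n) ∧
    ∀ q ∈ it.2.2, (∀ s ∈ q.1, s.length ≤ n) ∧ ∀ s ∈ q.2, s.length ≤ n))

theorem primrecPred_sizeLE : PrimrecPred fun p : Item × ℕ => p.1.SizeLE p.2 := by
  have h : ∀ {α : Type} [Primcodable α] {c : α → List (List Bool)} {n : α → ℕ}, Primrec c →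
      Primrec n → PrimrecPred fun a => ∀ s ∈ c a, s.length ≤ n a := fun hc hn =>
    primrecPred_forall_mem hc (Primrec.nat_le.comp (Primrec.list_length.comp .snd) (hn.comp .fst))
  refine (h (Primrec.fst.comp (Primrec.snd.comp .fst)) .snd).and ?_
  exact primrecPred_forall_mem (Primrec.snd.comp (Primrec.snd.comp .fst))
    ((h (Primrec.fst.comp .snd) (Primrec.snd.comp .fst)).and
      (h (Primrec.snd.comp .snd) (Primrec.snd.comp .fst)))

theorem Item.exists_sizeLE (it : Item) : ∃ N, ∀ n ≥ N, it.SizeLE n := by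
  have h : ∀ c : List (List Bool), ∃ N, ∀ s ∈ c, s.length ≤ N := fun c =>
    ((List.finite_toSet c).image List.length).bddAbove.imp fun N hN s hs =>
      hN (Set.mem_image_of_mem _ hs)
  have h' : ∀ P : PathData, ∃ N, ∀ n ≥ N, P.SizeLE n := by
    intro P
    induction P with
    | nil => exact ⟨0, fun n _ q hq => by simp at hq⟩
    | cons q P ih =>
      obtain ⟨N, hN⟩ := ih
      obtain ⟨N₁, h₁⟩ := h q.1
      obtain ⟨N₂, h₂⟩ := h q.2
      refine ⟨N + N₁ + N₂, fun n hn r hr => ?_⟩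
      rcases List.mem_cons.1 hr with rfl | hr
      · exact ⟨fun s hs => (h₁ s hs).trans (by omega), fun s hs => (h₂ s hs).trans (by omega)⟩
      · exact hN n (by omega) r hr
  obtain ⟨N₁, h₁⟩ := h it.2.1
  obtain ⟨N₂, h₂⟩ := h' it.2.2
  exact ⟨N₁ + N₂, fun n hn => ⟨fun s hs => (h₁ s hs).trans (by omega), h₂ n (by omega)⟩⟩

/-! ### Recognizing from approximations that the capital exceeds the threshold -/

theorem BettingStrategy.lt_capital_of_approx {B : BettingStrategy} {x : List Bool}
    (hx : x ∈ B.ref.coords) {c : List (List Bool)} (hc : unionSet c = B.ref.partSet x) {C n : ℕ}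
    {z : ℤ} (hz : |(B.mu.mass x : ℝ) - (z : ℝ) / 2 ^ n| ≤ 1 / 2 ^ n)
    (h : C * compatCount n c + 1 < z.toNat) : (C : ℝ≥0) < B.capital x := by
  rw [B.lt_capital_iff hx, ← hc]
  have h1 : (C : ℝ) * compatCount n c / 2 ^ n < B.mu.mass x := by
    have h2 : ((C * compatCount n c + 1 : ℕ) : ℝ) < z := by
      have : ((C * compatCount n c + 1 : ℕ) : ℤ) < z := by omega
      exact_mod_cast this
    have h3 := (abs_le.1 hz).1
    push_cast at h2
    have h4 : (0 : ℝ) < 2 ^ n := by positivity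
    have h5 : ((C : ℝ) * compatCount n c) / 2 ^ n < (z - 1) / 2 ^ n :=
      div_lt_div_of_pos_right (by linarith) h4
    rw [sub_div] at h5
    linarith
  have h2 : (C : ℝ≥0) * (compatCount n c * 2⁻¹ ^ n) < B.mu.mass x := by
    rw [← NNReal.coe_lt_coe]
    push_cast
    rwa [inv_pow, ← mul_assoc, ← div_eq_mul_inv]
  calc ((C : ℝ≥0) : ℝ≥0∞) * coinMeasure (unionSet c)
      ≤ ((C : ℝ≥0) : ℝ≥0∞) * (compatCount n c * 2⁻¹ ^ n) := by
        gcongr; exact coinMeasure_unionSet_le n c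
    _ = (((C : ℝ≥0) * (compatCount n c * 2⁻¹ ^ n) : ℝ≥0) : ℝ≥0∞) := by
        push_cast
        simp
    _ < B.mu.mass x := ENNReal.coe_lt_coe.2 h2

/-- Once `n` bounds the lengths in `c` the count is exact. The test then passes when the gap between
the mass and `C` times the measure exceeds `2 / 2 ^ n`: one unit for the error of `z`, one for the
`+ 1` that keeps the test sound. -/
theorem BettingStrategy.exists_approx_of_lt_capital {B : BettingStrategy} {x : List Bool}
    (hx : x ∈ B.ref.coords) {c : List (List Bool)} (hc : unionSet c = B.ref.partSet x) {C : ℕ}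
    (h : (C : ℝ≥0) < B.capital x) : ∃ n : ℕ, ∀ z : ℤ,
      |(B.mu.mass x : ℝ) - (z : ℝ) / 2 ^ n| ≤ 1 / 2 ^ n → C * compatCount n c + 1 < z.toNat := by
  rw [B.lt_capital_iff hx, ← hc] at h
  set r : ℝ := (coinMeasure (unionSet c)).toReal with hr
  have h1 : (C : ℝ) * r < B.mu.mass x := by
    have := (ENNReal.toReal_lt_toReal (ENNReal.mul_ne_top (by simp) (measure_ne_top _ _))
      (by simp)).2 h
    simpa using this
  obtain ⟨N, hN⟩ := ((List.finite_toSet c).image List.length).bddAbove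
  obtain ⟨M, hM⟩ := exists_pow_lt_of_lt_one
    (show (0 : ℝ) < ((B.mu.mass x : ℝ) - C * r) / 2 by linarith) (show (1 / 2 : ℝ) < 1 by norm_num)
  refine ⟨max N M, fun z hz => ?_⟩
  set n := max N M
  have hcount : (compatCount n c : ℝ) = r * 2 ^ n := by
    rw [hr, coinMeasure_unionSet_eq (n := n) fun s hs =>
      (hN (Set.mem_image_of_mem _ hs)).trans (le_max_left _ _)]
    simp
  have h4 : (0 : ℝ) < 2 ^ n := by positivity
  have h5 : (1 : ℝ) / 2 ^ n < ((B.mu.mass x : ℝ) - C * r) / 2 := by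
    rw [← one_div_pow]
    exact lt_of_le_of_lt (pow_le_pow_of_le_one (by norm_num) (by norm_num) (le_max_right N M)) hM
  have h6 := (abs_le.1 hz).2
  have h7 : (C : ℝ) * r + 1 / 2 ^ n < z / 2 ^ n := by linarith
  have h8 : ((C * compatCount n c + 1 : ℕ) : ℝ) < z := by
    push_cast
    rw [hcount, lt_div_iff₀ h4, add_mul, div_mul_cancel₀ _ h4.ne'] at *
    linarith
  have h9 : ((C * compatCount n c + 1 : ℕ) : ℤ) < z := by exact_mod_cast h8
  omega

theorem exists_enumerates {strat : Bool → BettingStrategy} (h : ∀ fl, (strat fl).IsComputable)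
    (C : ℕ) : ∃ item : ℕ → Option Item, Computable item ∧
      Enumerates (fun fl => (strat fl).ref) (fun fl => (strat fl).wonCoords C) item := by
  choose hcode hmass using h
  choose code hcode hpart using hcode
  choose a ha happ using hmass
  have hpart : ∀ fl t x, (strat fl).ref.part t x = (code fl (t, x)).map unionSet := hpart
  have hF : Partrec fun p : Bool × (ℕ × List Bool) × ℕ =>
      itemAt p.1 (code p.1) (a p.1) C p.2 := by
    refine (Partrec.cond (c := fun p : Bool × (ℕ × List Bool) × ℕ => p.1) Computable.fst
      ((partrec_itemAt true (hcode true) (ha true) C).comp Computable.snd)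
      ((partrec_itemAt false (hcode false) (ha false) C).comp Computable.snd)).of_eq fun p => ?_
    obtain ⟨fl, p⟩ := p
    cases fl <;> rfl
  obtain ⟨E, hE, hE₁, hE₂⟩ := exists_computable_enumeration hF
  -- Admitting an item only at stages `j` that bound its string lengths loses nothing, since it
  -- recurs later.
  refine ⟨fun j => (E j).bind fun o => o.bind fun it => if it.SizeLE j then some it else none,
    ?_, ?_⟩
  · refine Computable.option_bind hE (Computable.option_bind Computable.snd ?_)
    exact (Primrec.ite (primrecPred_sizeLE.comp
      (Primrec.pair .snd (Primrec.fst.comp .fst))) (Primrec.option_some.comp .snd)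
      (.const none)).to_comp
  · have key : ∀ j it, ((E j).bind fun o => o.bind fun it =>
        if it.SizeLE j then some it else none) = some it → E j = some (some it) ∧ it.SizeLE j := by
      intro j it hj
      obtain ⟨o, ho, hj⟩ := Option.bind_eq_some_iff.1 hj
      obtain ⟨it', ho', hj'⟩ := Option.bind_eq_some_iff.1 hj
      split_ifs at hj' with hs
      obtain rfl := Option.some_injective _ hj'
      exact ⟨ho'.symm ▸ ho, hs⟩
    refine ⟨fun j it hj => (key j it hj).2.1, fun j it hj => (key j it hj).2.2, ?_, ?_⟩
    · intro j it hj
      obtain ⟨⟨fl, ⟨t, x⟩, n⟩, hp⟩ := hE₁ j _ (key j it hj).1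
      obtain ⟨P, hP, h⟩ := Part.mem_bind_iff.1 hp
      obtain ⟨c, hc, h⟩ := Part.mem_bind_iff.1 h
      obtain ⟨z, hz, h⟩ := (Part.mem_map_iff _).1 h
      split_ifs at h with hlt
      obtain rfl := Option.some_injective _ h
      obtain ⟨hx, hcx⟩ := unionSet_eq_partSet (hpart fl) hc
      have hpath := isPath_of_mem_pathUpTo (hpart fl) le_rfl hP
      rw [List.take_length] at hpath
      refine ⟨x, ⟨hx, ?_⟩, hpath, hcx⟩
      obtain ⟨z', hz', hap⟩ := happ fl x hx n
      obtain rfl := Part.mem_unique hz hz'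
      exact BettingStrategy.lt_capital_of_approx hx hcx hap hlt
    · rintro fl x ⟨hx, hcap⟩
      obtain ⟨t, ht⟩ := hx
      obtain ⟨P, hP⟩ := exists_mem_pathUpTo (hpart fl) le_rfl ht
      obtain ⟨c, hc⟩ : ∃ c, c ∈ code fl (t, x) := by
        rw [hpart] at ht
        exact ⟨(code fl (t, x)).get ht, Part.get_mem _⟩
      obtain ⟨hx, hcx⟩ := unionSet_eq_partSet (hpart fl) hc
      obtain ⟨n, hn⟩ := BettingStrategy.exists_approx_of_lt_capital hx hcx hcap
      obtain ⟨z, hz, hap⟩ := happ fl x hx n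
      have hmem : some (fl, c, P) ∈ itemAt fl (code fl) (a fl) C ((t, x), n) := by
        refine Part.mem_bind hP (Part.mem_bind hc ((Part.mem_map_iff _).2 ⟨z, hz, ?_⟩))
        exact if_pos (hn z hap)
      obtain ⟨N, hN⟩ := Item.exists_sizeLE (fl, c, P)
      obtain ⟨j, hj, hEj⟩ := hE₂ (fl, (t, x), n) _ hmem N
      refine ⟨j, (fl, c, P), ?_, hcx⟩
      simp only [hEj, Option.bind_some]
      exact if_pos (hN j hj)

open PartitionRefinement
open scoped ENNReal

/-! ### The main theorem -/

theorem exists_computable_levels {g : ℕ → ℝ} (hg : IsComputableRealOn Set.univ g)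
    (hg_unbdd : ∀ M : ℝ, ∃ l : ℕ, M < g l) :
    ∃ l : ℕ → ℕ, Computable l ∧ ∀ e, e + 4 ≤ l e ∧ ((e + 4 : ℕ) : ℝ) ≤ g (l e) := by
  obtain ⟨a, ha, hga⟩ := hg
  choose z hz hzg using fun l => hga l (Set.mem_univ l) 0
  simp only [pow_zero, div_one] at hzg
  have hzc : Computable z :=
    (ha.comp (Computable.pair Computable.id (Computable.const 0))).of_eq_tot hz
  -- `z l` is within `1` of `g l`: the test value `e + 5` guarantees `g l ≥ e + 4` and is reached
  -- once `g l > e + 6`. Large values of `g` occur at large `l`, as `g` is bounded on the finitely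
  -- many `l < e + 4`.
  have hex : ∀ e, ∃ l, e + 4 ≤ l ∧ e + 5 ≤ (z l).toNat := by
    intro e
    obtain ⟨M, hM⟩ := ((Set.finite_Iio (e + 4)).image g).bddAbove
    obtain ⟨l, hl⟩ := hg_unbdd (max M (e + 6))
    refine ⟨l, ?_, ?_⟩
    · by_contra hlt
      exact absurd (hM (Set.mem_image_of_mem g (Set.mem_Iio.2 (not_le.1 hlt))))
        (not_le.2 ((le_max_left _ _).trans_lt hl))
    · have h1 := (abs_le.1 (hzg l)).2
      have h2 := (le_max_right _ _).trans_lt hl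
      have h3 : ((e + 5 : ℕ) : ℝ) < z l := by push_cast; linarith
      have h4 : ((e + 5 : ℕ) : ℤ) < z l := by exact_mod_cast h3
      omega
  have hP : ComputablePred fun p : ℕ × ℕ => p.1 + 4 ≤ p.2 ∧ p.1 + 5 ≤ (z p.2).toNat := by
    have h : PrimrecPred fun q : (ℕ × ℕ) × ℕ => q.1.1 + 4 ≤ q.1.2 ∧ q.1.1 + 5 ≤ q.2 := by
      have h1 : Primrec fun q : (ℕ × ℕ) × ℕ => q.1.1 := Primrec.fst.comp .fst
      exact (Primrec.nat_le.comp (Primrec.nat_add.comp h1 (.const 4)) (Primrec.snd.comp .fst)).and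
        (Primrec.nat_le.comp (Primrec.nat_add.comp h1 (.const 5)) .snd)
    refine Computable.computablePred ?_
    exact h.decide.to_comp.comp (Computable.pair Computable.id
      (primrec_int_toNat.to_comp.comp (hzc.comp Computable.snd)))
  refine ⟨fun e => Nat.find (hex e), Computable.find hP hex, fun e => ?_⟩
  obtain ⟨h1, h2⟩ := Nat.find_spec (hex e)
  refine ⟨h1, ?_⟩
  set l := Nat.find (hex e)
  have h3 := (abs_le.1 (hzg l)).1
  have h4 : ((e + 5 : ℕ) : ℤ) ≤ z l := by omega
  have h5 : ((e + 5 : ℕ) : ℝ) ≤ z l := by exact_mod_cast h4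
  push_cast at h5 ⊢
  linarith

/-- The strings selected by the `e`-th process, with small cylinders where there is none. -/
def testString (item : ℕ → Option Item) (s : ℕ → List Bool) (K : ℕ → ℕ) (pos : ℕ → List ℕ)
    (p : ℕ × ℕ) : List Bool :=
  ((selected item (s p.1) (K p.1) (pos p.1) p.2.unpair.1)[p.2.unpair.2]?).getD
    (List.replicate (p.1 + p.2 + 2) false)

theorem primrec_replicate_false : Primrec fun n : ℕ => List.replicate n false := by
  refine (Primrec.list_map Primrec.list_range (g := fun _ _ => false) (Primrec.const false)).of_eq
    fun n => ?_
  simp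

section TestString

variable {item : ℕ → Option Item} {s : ℕ → List Bool} {K : ℕ → ℕ} {pos : ℕ → List ℕ}

theorem computable_testString (hitem : Computable item) (hs : Computable s) (hK : Computable K)
    (hpos : Computable pos) : Computable (testString item s K pos) := by
  have hu : Computable fun p : ℕ × ℕ => p.2.unpair := Computable.unpair.comp .snd
  refine Computable.option_getD (Computable.list_getElem?.comp
    ((computable_selected hitem hs hK hpos).comp
      (Computable.pair Computable.fst (Computable.fst.comp hu))) (Computable.snd.comp hu)) ?_
  exact (primrec_replicate_false.comp (Primrec.nat_add.comp (Primrec.nat_add.comp .fst .snd)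
    (.const 2))).to_comp

theorem exists_testString_eq {e n : ℕ} {τ : List Bool}
    (h : τ ∈ selected item (s e) (K e) (pos e) n) :
    ∃ i, testString item s K pos (e, i) = τ := by
  obtain ⟨k, hk, rfl⟩ := List.getElem_of_mem h
  exact ⟨Nat.pair n k, by simp [testString, hk]⟩

/-- A test must be total, hence the filler strings. Their lengths `e + i + 2` make their cylinders
sum to `2⁻¹ ^ (e + 1)`. -/
theorem coinMeasure_iUnion_testString_le (e : ℕ) :
    coinMeasure (⋃ i, basicSet (testString item s K pos (e, i))) ≤
      coinMeasure (selectedSet item (s e) (K e) (pos e)) + 2⁻¹ ^ (e + 1) := by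
  have hsub : (⋃ i, basicSet (testString item s K pos (e, i))) ⊆
      selectedSet item (s e) (K e) (pos e) ∪ ⋃ i, basicSet (List.replicate (e + i + 2) false) := by
    refine Set.iUnion_subset fun i => ?_
    rw [testString]
    cases h : (selected item (s e) (K e) (pos e) i.unpair.1)[i.unpair.2]? with
    | none =>
      rw [Option.getD_none]
      exact fun σ hσ => Or.inr (Set.mem_iUnion.2 ⟨i, hσ⟩)
    | some τ =>
      rw [Option.getD_some]
      exact fun σ hσ => Or.inl (mem_selectedSet.2 ⟨_, τ, List.mem_of_getElem? h, hσ⟩)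
  refine (measure_mono hsub).trans ((measure_union_le _ _).trans (add_le_add le_rfl ?_))
  calc coinMeasure (⋃ i, basicSet (List.replicate (e + i + 2) false))
      ≤ ∑' i, (2⁻¹ : ℝ≥0∞) ^ (e + 2) * 2⁻¹ ^ i := by
        refine (measure_iUnion_le _).trans (ENNReal.tsum_le_tsum fun i => ?_)
        rw [coinMeasure_basicSet, List.length_replicate, ← pow_add, add_right_comm]
    _ = 2⁻¹ ^ (e + 1) := by
        rw [ENNReal.tsum_mul_left, ENNReal.tsum_geometric, ENNReal.one_sub_inv_two, inv_inv,
          pow_succ, mul_assoc, ENNReal.inv_mul_cancel (by simp) (by simp), mul_one]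

end TestString

/-- Each strategy splits every part containing `σ` at most `f l` times on the first `l` positions
of `π`, for all `l ≥ L`. -/
def SplitsBoundedFrom (strat : Bool → BettingStrategy) (π : ℕ → ℕ) (f : ℕ → ℝ) (L : ℕ)
    (σ : BinSeq) : Prop :=
  ∀ l ≥ L, ∀ fl x, σ ∈ (strat fl).ref.partSet x →
    (splitCount (strat fl).ref (tailRestriction π l σ) x : ℝ) ≤ f l

/-- Countable additivity makes the threshold in "all but finitely many `l`" uniform on a subset of
positive measure. -/
theorem exists_splitsBoundedFrom {strat : Bool → BettingStrategy} {π : ℕ → ℕ} {f : ℕ → ℝ}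
    (h : ∀ fl, (strat fl).SplitsUpperBounded π f) {W : Set BinSeq} (hW : coinMeasure W ≠ 0) :
    ∃ L, coinMeasure {σ ∈ W | SplitsBoundedFrom strat π f L σ} ≠ 0 := by
  by_contra! hcon
  have hae : ∀ᵐ σ ∂coinMeasure, ∃ L, SplitsBoundedFrom strat π f L σ := by
    filter_upwards [h true, h false] with σ h₁ h₀
    obtain ⟨L₁, hL₁⟩ := Filter.eventually_atTop.1 h₁
    obtain ⟨L₀, hL₀⟩ := Filter.eventually_atTop.1 h₀
    refine ⟨max L₁ L₀, fun l hl fl x ⟨t, v, hv, hσ⟩ => ?_⟩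
    cases fl
    · exact hL₀ l ((le_max_right _ _).trans hl) t x v hv hσ
    · exact hL₁ l ((le_max_left _ _).trans hl) t x v hv hσ
  refine hW (measure_mono_null (t := {σ | ¬ ∃ L, SplitsBoundedFrom strat π f L σ} ∪
    ⋃ L, {σ ∈ W | SplitsBoundedFrom strat π f L σ}) (fun σ hσ => ?_)
    (measure_union_null (ae_iff.1 hae) (measure_iUnion_null hcon)))
  by_cases hL : ∃ L, SplitsBoundedFrom strat π f L σ
  · exact Or.inr (Set.mem_iUnion.2 (hL.imp fun L h => ⟨hσ, h⟩))
  · exact Or.inl hL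

end GenBet


open GenBet in
theorem mainTheorem1 (A B : GenBet.BettingStrategy)
    (hA : A.IsComputable) (hB : B.IsComputable)
    (π : ℕ → ℕ) (hπ : Computable π) (hπ_inj : Function.Injective π)
    (g : ℕ → ℝ) (hg : GenBet.IsComputableRealOn Set.univ g)
    (hg_unbdd : ∀ M : ℝ, ∃ l : ℕ, M < g l)
    (hsA : A.SplitsUpperBounded π fun l : ℕ => (l : ℝ) - Real.logb 2 (l : ℝ) - g l)
    (hsB : B.SplitsUpperBounded π fun l : ℕ => (l : ℝ) - Real.logb 2 (l : ℝ) - g l) :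
    ∃ σ : GenBet.BinSeq, ¬ GenBet.IsMLRandom σ ∧ ¬ A.Wins σ ∧ ¬ B.Wins σ := by
  let strat : Bool → BettingStrategy := fun fl => cond fl A B
  have hcomp : ∀ fl, (strat fl).IsComputable := fun fl => by cases fl <;> assumption
  have hsplit : ∀ fl, (strat fl).SplitsUpperBounded π
      fun l : ℕ => (l : ℝ) - Real.logb 2 (l : ℝ) - g l := fun fl => by cases fl <;> assumption
  obtain ⟨C, hC⟩ := exists_coinMeasure_inter_unwonSet_ne_zero A B
  obtain ⟨item, hitem, hE⟩ := exists_enumerates hcomp C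
  obtain ⟨l, hl, hlg⟩ := exists_computable_levels hg hg_unbdd
  -- The first component of `e` names the cylinder, so every string is served by infinitely many
  -- `e`.
  let s : ℕ → List Bool := fun e => (Encodable.decode (α := List Bool) e.unpair.1).getD []
  have hs : Computable s := Computable.option_getD
    (Computable.decode.comp (Computable.fst.comp Computable.unpair)) (Computable.const [])
  -- Of the `e + 4`, `3` pays for the count `2 ^ (K + 3)`, and `e + 1` gives measure `2⁻¹ ^ (e +
  -- 1)`, leaving the other half of `2⁻¹ ^ e` to the fillers.
  let K : ℕ → ℕ := fun e => l e - (e + 4)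
  have hK : Computable K := Primrec.nat_sub.to_comp.comp hl
    (Primrec.nat_add.comp .id (.const 4)).to_comp
  have hlK : ∀ e, l e = K e + 3 + (e + 1) := fun e => by
    have := (hlg e).1
    simp only [K]
    omega
  have key : ∃ σ ∈ A.unwonSet C ∩ B.unwonSet C, ¬ IsMLRandom σ := by
    refine exists_not_isMLRandom
      (computable_testString hitem hs hK ((computable_posList hπ).comp hl)) (fun e => ?_)
      ((A.isClosed_unwonSet C).inter (B.isClosed_unwonSet C)) hC (fun s₀ hs₀ N => ?_)
    · refine (coinMeasure_iUnion_testString_le e).trans ?_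
      have h := coinMeasure_selectedSet_le hE hπ_inj (s e) (K e) (e + 1)
      rw [← hlK e] at h
      refine (add_le_add h le_rfl).trans_eq ?_
      rw [pow_succ, ← mul_add, ENNReal.inv_two_add_inv_two, mul_one]
    · obtain ⟨L, hL⟩ := exists_splitsBoundedFrom hsplit hs₀
      -- This index serves `s₀` and is at least `N` and `L`; as `l e ≥ e + 4`, the split bound holds
      -- at `l e`.
      set e := Nat.pair (Encodable.encode s₀) (max N L) with he
      have heL : max N L ≤ e := Nat.right_le_pair _ _
      have hse : s e = s₀ := by simp [s, he]
      obtain ⟨hle, hge⟩ := hlg e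
      have hbound : (l e : ℝ) - Real.logb 2 (l e : ℝ) - g (l e) ≤ K e := by
        -- The logarithm is nonnegative and `g (l e) ≥ e + 4`, so the split bound is at most `l e -
        -- (e + 4) = K e`.
        have h1 : 0 ≤ Real.logb 2 (l e : ℝ) :=
          Real.logb_nonneg (by norm_num) (by exact_mod_cast (show 1 ≤ l e by omega))
        rw [Nat.cast_sub hle]
        linarith
      obtain ⟨n, τ, hτ, hpos⟩ := exists_selected_measure_pos (item := item) (s := s e) (K := K e)
        (pos := posList π (l e)) (π := π) (l := l e) (V := A.unwonSet C ∩ B.unwonSet C) hL (by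
          rintro σ ⟨⟨hσs, hσA, hσB⟩, hσL⟩
          obtain ⟨a, ha, has, hnw⟩ := exists_mem_selectedSet (K := K e) (l := l e) (π := π) hE
            (hse.symm ▸ hσs) (fun fl => by cases fl <;> assumption) (fun fl y hy => by
              have hlL : L ≤ l e := by
                have := le_max_right N L
                omega
              exact_mod_cast (hσL (l e) hlL fl y hy).trans hbound)
          exact ⟨a, ha, has, hnw true, hnw false⟩)
      obtain ⟨i, hi⟩ := exists_testString_eq (item := item) (s := s) (K := K)
        (pos := fun e => posList π (l e)) hτ
      refine ⟨e, (le_max_left N L).trans heL, i, ?_, ?_⟩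
      · rw [hi, ← hse]
        exact (prefix_of_mem_selected hτ).1
      · rwa [hi]
  obtain ⟨σ, hσ, hr⟩ := key
  exact ⟨σ, hr, A.not_wins_of_mem_unwonSet hσ.1, B.not_wins_of_mem_unwonSet hσ.2⟩
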